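/- Let $n\ge 2$ and let $E\subset\mathbb{R}^n$ be an open set whose topological boundary $\partial E$ is a nonempty, connected, compact (embedded) hypersurface of class $C^2$. Let $\kappa_1(z),\dots,\kappa_{n-1}(z)$ be the principal curvatures of $\partial E$ at $z$, put $\overline{\kappa}:=\max\{\sum_{i=1}^{n-1}|\kappa_i(z)| : z\in\partial E\}$ (which is positive), and fix $0<\delta<\frac{1}{2\overline{\kappa}}$. For $r\in(0,\delta)$ let $\mathcal U_r:=\{x\in\mathbb{R}^n:\operatorname{dist}(x,\partial E)<r\}$. Then there is a constant $C>0$, depending only on $n$, $\partial E$ and the fixed number $\delta$, such that for every $r\in(0,\delta)$ and every $A\subset\mathbb{R}^n$ with $\chi_A\in BV_{loc}(\mathbb{R}^n)$, $$ \min\big\{\|\chi_A\|_{L^1(\mathcal U_r)},\ \|1-\chi_A\|_{L^1(\mathcal U_r)}\big\}\ \le\ C\left(\frac{\delta}{r}\right)^{\frac{1}{n-1}}\big(|\nabla\chi_A|(\mathcal U_r)\big)^{\frac{n}{n-1}}, $$ where, for open $U\subset\mathbb{R}^n$, $|\nabla\chi_A|(U)=\sup\{\int_A\operatorname{div}\varphi\,dx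 : \varphi\in C^1_c(U;\mathbb{R}^n),\ |\varphi|\le 1\}$ denotes the total variation on $U$ of the distributional gradient of $\chi_A$. -/

import Mathlib

open MeasureTheory

noncomputable section

/-- Euclidean `n`-space with the Euclidean norm. -/
abbrev Euc (n : ℕ) : Type := EuclideanSpace ℝ (Fin n)

/-! ### Hypersurfaces of class `C²` and their principal curvatures -/

/-- `f` is a `C²` defining function of `S` near `z`: on some open neighbourhood `V` of `z` the
function `f` is of class `C²`, has no critical point, and `S ∩ V` is its zero set in `V`. -/
def IsLocalDefiningFunction {n : ℕ} (S : Set (Euc n)) (z : Euc n) (f : Euc n → ℝ) : Prop :=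
  ∃ V : Set (Euc n), IsOpen V ∧ z ∈ V ∧ ContDiffOn ℝ 2 f V ∧
    (∀ x ∈ V, gradient f x ≠ 0) ∧ S ∩ V = {x ∈ V | f x = 0}

/-- `S` is an (embedded, boundaryless) hypersurface of class `C²`: near each of its points it is
the regular zero set of a `C²` function. -/
def IsC2Hypersurface {n : ℕ} (S : Set (Euc n)) : Prop :=
  ∀ z ∈ S, ∃ f : Euc n → ℝ, IsLocalDefiningFunction S z f

/-- The shape operator at `z` of the level set of `f` through `z`, with respect to the unit normal
`∇f / |∇f|`: the endomorphism `v ↦ - |∇f(z)|⁻¹ P (D(∇f)(z) v)` of the tangent space `∇f(z)ᗮ`,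
where `P` is the orthogonal projection onto that space. -/
def shapeOperator {n : ℕ} (f : Euc n → ℝ) (z : Euc n) :
    (Submodule.span ℝ {gradient f z})ᗮ →ₗ[ℝ] (Submodule.span ℝ {gradient f z})ᗮ :=
  (-‖gradient f z‖⁻¹) •
    ((((Submodule.span ℝ {gradient f z})ᗮ.orthogonalProjectionOnto).comp
      ((fderiv ℝ (gradient f) z).comp (Submodule.span ℝ {gradient f z})ᗮ.subtypeL)) :
      (Submodule.span ℝ {gradient f z})ᗮ →L[ℝ] (Submodule.span ℝ {gradient f z})ᗮ)

/-- The principal curvatures `κ₁, …, κₙ₋₁` at `z` of the level set of `f` through `z`: the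
eigenvalues of the (symmetric) shape operator, with multiplicity. -/
def principalCurvatures {n : ℕ} (f : Euc n → ℝ) (z : Euc n) : Multiset ℝ :=
  (shapeOperator f z).charpoly.roots

/-- `max { ∑ᵢ |κᵢ(z)| : z ∈ S }`. The sum at `z` does not depend on the defining function: another
choice changes at most the common sign of the principal curvatures. -/
def maxAbsCurvature {n : ℕ} (S : Set (Euc n)) : ℝ :=
  sSup {k : ℝ | ∃ z ∈ S, ∃ f : Euc n → ℝ, IsLocalDefiningFunction S z f ∧
    k = ((principalCurvatures f z).map (fun κ => |κ|)).sum}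

/-! ### Functions of locally bounded variation -/

/-- The divergence of a vector field. -/
def divergence {n : ℕ} (φ : Euc n → Euc n) (x : Euc n) : ℝ :=
  ∑ i : Fin n, (fderiv ℝ φ x (EuclideanSpace.single i 1)) i

/-- Admissible test fields on `W`: vector fields `φ ∈ C¹_c(W; ℝⁿ)` with `|φ| ≤ 1`. -/
def IsTestField {n : ℕ} (W : Set (Euc n)) (φ : Euc n → Euc n) : Prop :=
  ContDiff ℝ 1 φ ∧ HasCompactSupport φ ∧ tsupport φ ⊆ W ∧ ∀ x, ‖φ x‖ ≤ 1

/-- The total variation `|∇u|(W) = sup { ∫ u div φ : φ ∈ C¹_c(W; ℝⁿ), |φ| ≤ 1 }` of the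
distributional gradient of a locally integrable function `u` on an open set `W`. -/
def totalVariation {n : ℕ} (u : Euc n → ℝ) (W : Set (Euc n)) : ENNReal :=
  ⨆ (φ : Euc n → Euc n) (_ : IsTestField W φ), ENNReal.ofReal (∫ x, u x * divergence φ x)

/-- `u ∈ BV_loc(ℝⁿ)`. -/
def IsBVloc {n : ℕ} (u : Euc n → ℝ) : Prop :=
  LocallyIntegrable u volume ∧
    ∀ W : Set (Euc n), IsOpen W → Bornology.IsBounded W → totalVariation u W < ⊤

/-- The characteristic function of a set. -/
def charFn {n : ℕ} (A : Set (Euc n)) : Euc n → ℝ := A.indicator (fun _ => 1)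

/-- The open `r`-tube `{x : dist(x, S) < r}` around a nonempty set `S`. -/
def tube {n : ℕ} (S : Set (Euc n)) (r : ℝ) : Set (Euc n) := {x | Metric.infDist x S < r}

end

/-! The core is a Poincaré–Sobolev inequality in weak form: for every `C¹` function `u` there is a
constant `c` with `∫_F |u - c| ≤ K r^(-1/n) |F|^(1/n) ∫ |∇u|` for all measurable `F` in the tube of
radius `r` at once. This is the dual form of a weak `L^(n/(n-1))` bound, and for indicators weak is
as good as strong: if `u = χ_A`, then `|u - c| ≥ 1/2` on `F = A ∩ U` or on `F = U \ A`, so `|F| / 2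
≤ K r^(-1/n) |F|^(1/n) P`. Solving for `|F|` produces the exponent `n/(n-1)` of the perimeter and
the factor `r^(-1/(n-1))`.

On a fixed ball the weak inequality comes from the fundamental theorem of calculus along segments,
averaged over one endpoint (`exists_lintegral_enorm_sub_le_ball`). Near a point of the hypersurface
`S`, a `C¹` chart straightens `S`; squeezing its normal direction by a factor `s` turns the fixed
ball into a curved slab of thickness of order `s`, and the change of variables costs exactly
`s^(-1/n)` (`StraighteningChart.exists_lintegral_slab_le`).

Two such sets, of volume `O(r)` and overlapping in volume at least of order `r`, can be glued,
because the overlap forces their constants `c` to be close (`IsPoincareFamily.union`). Connectedness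
and compactness of `S` then give the inequality on a set containing a thinner tube of radius `b r`.
It extends to the tube of radius `r` (`exists_lintegral_tube_le`), since each point of that tube
lies in a ball `B(p, r)` with `p ∈ S`; this ball is convex, stays in the tube and contains `B(p, b
r)`.

Sets of finite perimeter are reached by mollification: the gradient mass on a compact subset is
bounded by the total variation on the surrounding open set, and Fatou's lemma handles the limit. -/

/-! ### Segment potentials and the weak Poincaré–Sobolev inequality on a ball -/

/-- The average over scales `s ∈ (0, 1)` of the masses of `g` on `U ∩ B̄(x, R s)`, weighted by
`s⁻ⁿ`; it plays the role of the Riesz potential of order one of `g`. -/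
noncomputable def segmentPotential {n : ℕ} (g : Euc n → ENNReal) (U : Set (Euc n)) (R : ℝ)
    (x : Euc n) : ENNReal :=
  ∫⁻ s in Set.Ioo (0 : ℝ) 1,
    ENNReal.ofReal (s ^ n)⁻¹ * ∫⁻ w in U ∩ Metric.closedBall x (R * s), g w

lemma lintegral_comp_homothety {n : ℕ} (f : Euc n → ENNReal) (hf : Measurable f) (x : Euc n)
    {s : ℝ} (hs : 0 < s) :
    ∫⁻ y, f (x + s • (y - x)) = ENNReal.ofReal (s ^ n)⁻¹ * ∫⁻ w, f w := by
  have h1 : ∫⁻ y, f (x + s • (y - x)) = ∫⁻ y, f (s • y + (x - s • x)) := by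
    congr 1; ext y; congr 1; rw [smul_sub]; abel
  have h2 : ∫⁻ y, f (s • y + (x - s • x)) =
      ∫⁻ z, f (z + (x - s • x)) ∂(Measure.map (s • ·) (volume : Measure (Euc n))) := by
    exact (lintegral_map (f := fun z => f (z + (x - s • x))) (hf.comp (measurable_add_const _))
      (measurable_const_smul s)).symm
  rw [h1, h2, Measure.map_addHaar_smul _ hs.ne', lintegral_smul_measure, lintegral_add_right_eq_self,
    abs_of_pos (by positivity)]
  simp

lemma enorm_sub_le_lintegral_segment {n : ℕ} {U : Set (Euc n)} (hU : IsOpen U) {v : Euc n → ℝ}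
    (hv : ContDiffOn ℝ 1 v U) {x y : Euc n} (hxy : segment ℝ x y ⊆ U) :
    ‖v x - v y‖ₑ ≤ ∫⁻ s in Set.Ioo (0 : ℝ) 1, ‖fderiv ℝ v (x + s • (y - x))‖ₑ * ‖y - x‖ₑ := by
  have hmem : ∀ s ∈ Set.Icc (0 : ℝ) 1, x + s • (y - x) ∈ U := fun s hs =>
    hxy (by rw [segment_eq_image']; exact ⟨s, hs, rfl⟩)
  have hder : ∀ s ∈ Set.uIcc (0 : ℝ) 1, HasDerivAt (fun s : ℝ => v (x + s • (y - x)))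
      (fderiv ℝ v (x + s • (y - x)) (y - x)) s := by
    intro s hs
    rw [Set.uIcc_of_le zero_le_one] at hs
    have h1 : HasFDerivAt v (fderiv ℝ v (x + s • (y - x))) (x + s • (y - x)) :=
      ((hv.contDiffAt (hU.mem_nhds (hmem s hs))).differentiableAt one_ne_zero).hasFDerivAt
    have h2 : HasDerivAt (fun s : ℝ => x + s • (y - x)) (y - x) s := by
      simpa using ((hasDerivAt_id s).smul_const (y - x)).const_add x
    exact h1.comp_hasDerivAt s h2
  have hcont : ContinuousOn (fun s : ℝ => fderiv ℝ v (x + s • (y - x)) (y - x))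
      (Set.uIcc (0 : ℝ) 1) := by
    rw [Set.uIcc_of_le zero_le_one]
    have h3 : ContinuousOn (fderiv ℝ v) U := hv.continuousOn_fderiv_of_isOpen hU le_rfl
    exact (h3.comp (by fun_prop) hmem).clm_apply continuousOn_const
  have := intervalIntegral.integral_eq_sub_of_hasDerivAt hder hcont.intervalIntegrable
  simp only [one_smul, zero_smul, add_zero, add_sub_cancel] at this
  rw [← enorm_neg, neg_sub, ← this, intervalIntegral.integral_of_le zero_le_one,
    ← integral_Ioc_eq_integral_Ioo.symm]
  refine (enorm_integral_le_lintegral_enorm _).trans ?_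
  rw [restrict_Ioo_eq_restrict_Ioc]
  exact lintegral_mono fun s => ContinuousLinearMap.le_opENorm _ _

lemma measurable_indicator_enorm_fderiv {n : ℕ} {U : Set (Euc n)} (hU : IsOpen U) {v : Euc n → ℝ} :
    Measurable (U.indicator fun w => ‖fderiv ℝ v w‖ₑ) :=
  ((measurable_fderiv ℝ v).enorm).indicator hU.measurableSet

/-- Integrate the fundamental theorem of calculus on `[x, y]` over `y ∈ B`, exchange the integrals,
and substitute `w = x + s (y - x)` for fixed `s`. The Jacobian is `s⁻ⁿ`, and `w` stays within `R s`
of `x`. Only segments from `x` to `B` need lie in `U`, so non-convex tubes are allowed. -/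
lemma lintegral_enorm_sub_le_segmentPotential {n : ℕ} {U : Set (Euc n)} (hU : IsOpen U)
    {v : Euc n → ℝ} (hv : ContDiffOn ℝ 1 v U) {x : Euc n} {B : Set (Euc n)} (hB : MeasurableSet B)
    {R : ℝ} (hxB : ∀ y ∈ B, segment ℝ x y ⊆ U ∧ dist y x ≤ R) :
    ∫⁻ y in B, ‖v x - v y‖ₑ ≤
      ENNReal.ofReal R * segmentPotential (fun w => ‖fderiv ℝ v w‖ₑ) U R x := by
  set g : Euc n → ENNReal := U.indicator fun w => ‖fderiv ℝ v w‖ₑ with hg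
  have hgm : Measurable g := measurable_indicator_enorm_fderiv hU
  calc ∫⁻ y in B, ‖v x - v y‖ₑ
      ≤ ∫⁻ y in B, ∫⁻ s in Set.Ioo (0 : ℝ) 1, g (x + s • (y - x)) * ENNReal.ofReal R := by
        refine setLIntegral_mono_ae' hB (ae_of_all _ fun y hy => ?_)
        refine (enorm_sub_le_lintegral_segment hU hv (hxB y hy).1).trans ?_
        refine setLIntegral_mono_ae' measurableSet_Ioo (ae_of_all _ fun s hs => ?_)
        have hmem : x + s • (y - x) ∈ U := (hxB y hy).1 (by
          rw [segment_eq_image']; exact ⟨s, ⟨hs.1.le, hs.2.le⟩, rfl⟩)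
        rw [hg, Set.indicator_of_mem hmem]
        gcongr
        rw [← ofReal_norm, ← dist_eq_norm]
        exact ENNReal.ofReal_le_ofReal (hxB y hy).2
    _ = ∫⁻ s in Set.Ioo (0 : ℝ) 1, ∫⁻ y in B, g (x + s • (y - x)) * ENNReal.ofReal R := by
        rw [lintegral_lintegral_swap]
        refine Measurable.aemeasurable ?_
        refine Measurable.mul_const (hgm.comp ?_) _
        fun_prop
    _ ≤ ∫⁻ s in Set.Ioo (0 : ℝ) 1, ENNReal.ofReal R * (ENNReal.ofReal (s ^ n)⁻¹ *
          ∫⁻ w in U ∩ Metric.closedBall x (R * s), ‖fderiv ℝ v w‖ₑ) := by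
        refine setLIntegral_mono_ae' measurableSet_Ioo (ae_of_all _ fun s hs => ?_)
        rw [lintegral_mul_const' _ _ ENNReal.ofReal_ne_top, mul_comm]
        gcongr
        set f : Euc n → ENNReal := (Metric.closedBall x (R * s)).indicator g with hf
        have hfm : Measurable f := hgm.indicator Metric.isClosed_closedBall.measurableSet
        calc ∫⁻ y in B, g (x + s • (y - x)) ≤ ∫⁻ y in B, f (x + s • (y - x)) := by
              refine setLIntegral_mono_ae' hB (ae_of_all _ fun y hy => ?_)
              rw [hf, Set.indicator_of_mem]
              rw [Metric.mem_closedBall, dist_eq_norm, add_sub_cancel_left, norm_smul,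
                Real.norm_of_nonneg hs.1.le, mul_comm, ← dist_eq_norm]
              exact mul_le_mul_of_nonneg_right (hxB y hy).2 hs.1.le
          _ ≤ ∫⁻ y, f (x + s • (y - x)) := setLIntegral_le_lintegral _ _
          _ = _ := by
              rw [lintegral_comp_homothety f hfm x hs.1, hf,
                lintegral_indicator Metric.isClosed_closedBall.measurableSet, hg,
                setLIntegral_indicator hU.measurableSet]
    _ = _ := by
        rw [lintegral_const_mul' _ _ ENNReal.ofReal_ne_top]
        rfl

/-- At small scales `|F ∩ B(w, R s)|` is bounded by the volume of the ball, at large scales by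
`|F|`. The resulting integrand `s⁻ⁿ |F|` is integrable at infinity because `n ≥ 2`. -/
lemma lintegral_scales_le {n : ℕ} (hn : 2 ≤ n) {R : ℝ} (hR : 0 < R) {F : Set (Euc n)}
    (w : Euc n) :
    ∫⁻ s in Set.Ioo (0 : ℝ) 1,
      ENNReal.ofReal (s ^ n)⁻¹ * volume (F ∩ Metric.closedBall w (R * s)) ≤
    (ENNReal.ofReal (R ^ (n - 1)) * (volume (Metric.closedBall (0 : Euc n) 1) + 1)) *
      volume F ^ (1 / (n : ℝ)) := by
  have hn0 : (0 : ℝ) < n := by positivity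
  rcases eq_or_ne (volume F) 0 with h0 | h0
  · have : ∀ s : ℝ, volume (F ∩ Metric.closedBall w (R * s)) = 0 := fun s =>
      measure_mono_null Set.inter_subset_left h0
    simp [this]
  rcases eq_or_ne (volume F) ⊤ with htop | htop
  · rw [htop, ENNReal.top_rpow_of_pos (by positivity), ENNReal.mul_top]
    · exact le_top
    · have : ENNReal.ofReal (R ^ (n - 1)) ≠ 0 := by simpa using pow_pos hR _
      exact mul_ne_zero this (by simp)
  set m : ℝ := (volume F).toReal with hm
  have hmF : volume F = ENNReal.ofReal m := (ENNReal.ofReal_toReal htop).symm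
  have hmpos : 0 < m := ENNReal.toReal_pos h0 htop
  set b : ℝ := m ^ (1 / (n : ℝ)) with hb
  have hbpos : 0 < b := Real.rpow_pos_of_pos hmpos _
  have hbn : b ^ n = m := by
    rw [hb, one_div, Real.rpow_inv_natCast_pow hmpos.le (by lia)]
  set ω := volume (Metric.closedBall (0 : Euc n) 1) with hω
  -- The crossover scale, at which `(R a)ⁿ = |F|`; both pieces are then of order `R^(n-1)
  -- |F|^(1/n)`.
  set a := b / R with ha
  have hapos : 0 < a := by positivity
  have hball : ∀ s : ℝ, 0 < s → volume (Metric.closedBall w (R * s)) =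
      ENNReal.ofReal ((R * s) ^ n) * ω := by
    intro s hs
    rw [Measure.addHaar_closedBall' _ _ (by positivity)]
    simp [hω]
  have hsub : Set.Ioo (0 : ℝ) 1 ⊆ Set.Ioc 0 a ∪ Set.Ioi a := by
    intro s hs
    rcases le_or_gt s a with h | h
    · exact Or.inl ⟨hs.1, h⟩
    · exact Or.inr h
  have hone : ∫⁻ s in Set.Ioc (0 : ℝ) a,
      ENNReal.ofReal (s ^ n)⁻¹ * volume (F ∩ Metric.closedBall w (R * s)) ≤
      ENNReal.ofReal (R ^ (n - 1)) * ω * ENNReal.ofReal b := by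
    calc _ ≤ ∫⁻ s in Set.Ioc (0 : ℝ) a, ENNReal.ofReal (R ^ n) * ω := by
          refine setLIntegral_mono_ae' measurableSet_Ioc (ae_of_all _ fun s hs => ?_)
          have hs0 : 0 < s := hs.1
          calc _ ≤ ENNReal.ofReal (s ^ n)⁻¹ * (ENNReal.ofReal ((R * s) ^ n) * ω) := by
                gcongr
                rw [← hball s hs.1]
                exact measure_mono Set.inter_subset_right
            _ = _ := by
                rw [← mul_assoc, ← ENNReal.ofReal_mul (by positivity)]
                congr 2
                field_simp
                ring
      _ = _ := by
          rw [setLIntegral_const, Real.volume_Ioc, sub_zero, mul_right_comm,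
            mul_right_comm _ ω, ← ENNReal.ofReal_mul (by positivity),
            ← ENNReal.ofReal_mul (by positivity)]
          congr 2
          rw [ha, ← Nat.sub_add_cancel (show 1 ≤ n by lia), pow_succ]
          field_simp
          simp
  have htwo : ∫⁻ s in Set.Ioi a,
      ENNReal.ofReal (s ^ n)⁻¹ * volume (F ∩ Metric.closedBall w (R * s)) ≤
      ENNReal.ofReal (R ^ (n - 1)) * ENNReal.ofReal b := by
    have hlt : -(n : ℝ) < -1 := by
      have : (2 : ℝ) ≤ n := by exact_mod_cast hn
      linarith
    calc _ ≤ ∫⁻ s in Set.Ioi a, ENNReal.ofReal (s ^ (-(n : ℝ))) * ENNReal.ofReal m := by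
          refine setLIntegral_mono_ae' measurableSet_Ioi (ae_of_all _ fun s hs => ?_)
          have hs0 : 0 < s := hapos.trans hs
          rw [Real.rpow_neg hs0.le, Real.rpow_natCast, ← hmF]
          gcongr
          exact Set.inter_subset_left
      _ = ENNReal.ofReal (∫ s in Set.Ioi a, s ^ (-(n : ℝ))) * ENNReal.ofReal m := by
          rw [lintegral_mul_const' _ _ ENNReal.ofReal_ne_top, ofReal_integral_eq_lintegral_ofReal]
          · exact integrableOn_Ioi_rpow_of_lt hlt hapos
          · filter_upwards [ae_restrict_mem measurableSet_Ioi] with s hs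
            exact Real.rpow_nonneg (hapos.trans hs).le _
      _ ≤ _ := by
          rw [integral_Ioi_rpow_of_lt hlt hapos, ← ENNReal.ofReal_mul' hmpos.le,
            ← ENNReal.ofReal_mul (by positivity)]
          refine ENNReal.ofReal_le_ofReal ?_
          obtain ⟨k, rfl⟩ : ∃ k, n = k + 2 := ⟨n - 2, by lia⟩
          have e1 : -((k + 2 : ℕ) : ℝ) + 1 = -((k + 1 : ℕ) : ℝ) := by push_cast; ring
          rw [e1, Real.rpow_neg hapos.le, Real.rpow_natCast, ← hbn, ha]
          have e2 : k + 2 - 1 = k + 1 := by lia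
          rw [e2, neg_div_neg_eq, div_pow]
          have e3 : (R ^ (k + 1) * b) / ((k + 1 : ℕ) : ℝ) ≤ R ^ (k + 1) * b :=
            div_le_self (by positivity) (by push_cast; linarith [Nat.cast_nonneg (α := ℝ) k])
          refine le_of_eq_of_le ?_ e3
          field_simp
          ring
  calc _ ≤ ∫⁻ s in Set.Ioc 0 a ∪ Set.Ioi a,
          ENNReal.ofReal (s ^ n)⁻¹ * volume (F ∩ Metric.closedBall w (R * s)) :=
        lintegral_mono_set hsub
    _ ≤ _ := lintegral_union_le _ _ _
    _ ≤ _ := add_le_add hone htwo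
    _ = _ := by
        rw [hmF, ENNReal.ofReal_rpow_of_pos hmpos]
        ring

lemma measurable_scale_integrand {n : ℕ} {g : Euc n → ENNReal} (hg : Measurable g) (R : ℝ) :
    Measurable fun p : (Euc n × ℝ) × Euc n =>
      ENNReal.ofReal (p.1.2 ^ n)⁻¹ *
        {q : (Euc n × ℝ) × Euc n | dist q.2 q.1.1 ≤ R * q.1.2}.indicator (fun q => g q.2) p := by
  refine Measurable.mul (by fun_prop) (Measurable.indicator (by fun_prop) ?_)
  exact (isClosed_le (by fun_prop) (by fun_prop)).measurableSet

/-- By Tonelli, the mass of `‖fderiv ℝ v w‖ₑ` at `w` is weighted by the scale integral of `|F ∩ B(w,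
R s)|`, which `lintegral_scales_le` bounds uniformly in `w`. -/
lemma lintegral_segmentPotential_le {n : ℕ} (hn : 2 ≤ n) {R : ℝ} (hR : 0 < R) {U : Set (Euc n)}
    (hU : IsOpen U) (v : Euc n → ℝ) {F : Set (Euc n)} (hF : MeasurableSet F) :
    ∫⁻ x in F, segmentPotential (fun w => ‖fderiv ℝ v w‖ₑ) U R x ≤
    (ENNReal.ofReal (R ^ (n - 1)) * (volume (Metric.closedBall (0 : Euc n) 1) + 1)) *
      volume F ^ (1 / (n : ℝ)) * ∫⁻ w in U, ‖fderiv ℝ v w‖ₑ := by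
  set g : Euc n → ENNReal := U.indicator fun w => ‖fderiv ℝ v w‖ₑ with hg
  have hgm : Measurable g := measurable_indicator_enorm_fderiv hU
  set Φ : (Euc n × ℝ) × Euc n → ENNReal := fun p => ENNReal.ofReal (p.1.2 ^ n)⁻¹ *
        {q : (Euc n × ℝ) × Euc n | dist q.2 q.1.1 ≤ R * q.1.2}.indicator (fun q => g q.2) p with hΦ
  have hΦm : Measurable Φ := measurable_scale_integrand hgm R
  have h1 : ∀ x, segmentPotential (fun w => ‖fderiv ℝ v w‖ₑ) U R x =
      ∫⁻ s in Set.Ioo (0 : ℝ) 1, ∫⁻ w, Φ ((x, s), w) := by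
    intro x
    refine lintegral_congr fun s => ?_
    simp only [hΦ]
    rw [lintegral_const_mul' _ _ ENNReal.ofReal_ne_top]
    congr 1
    rw [← setLIntegral_indicator hU.measurableSet,
      ← lintegral_indicator Metric.isClosed_closedBall.measurableSet]
    rfl
  have h2 : ∀ x, ∫⁻ s in Set.Ioo (0 : ℝ) 1, ∫⁻ w, Φ ((x, s), w) =
      ∫⁻ w, ∫⁻ s in Set.Ioo (0 : ℝ) 1, Φ ((x, s), w) := fun x => by
    rw [lintegral_lintegral_swap]
    exact (hΦm.comp (by fun_prop : Measurable fun q : ℝ × Euc n => ((x, q.1), q.2))).aemeasurable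
  simp_rw [h1, h2]
  rw [lintegral_lintegral_swap]
  swap
  · refine Measurable.aemeasurable ?_
    have : Measurable fun q : (Euc n × Euc n) × ℝ => Φ ((q.1.1, q.2), q.1.2) :=
      hΦm.comp (by fun_prop)
    exact this.lintegral_prod_right'
  have h3 : ∀ w, ∫⁻ x in F, ∫⁻ s in Set.Ioo (0 : ℝ) 1, Φ ((x, s), w) ≤
      (ENNReal.ofReal (R ^ (n - 1)) * (volume (Metric.closedBall (0 : Euc n) 1) + 1)) *
      volume F ^ (1 / (n : ℝ)) * g w := by
    intro w
    rw [lintegral_lintegral_swap]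
    swap
    · exact (hΦm.comp (by fun_prop : Measurable fun q : Euc n × ℝ => ((q.1, q.2), w))).aemeasurable
    refine le_trans (le_of_eq ?_) (mul_le_mul_left (lintegral_scales_le hn hR (F := F) w) (g w))
    rw [← lintegral_mul_const]
    · refine lintegral_congr fun s => ?_
      simp only [hΦ]
      rw [lintegral_const_mul' _ _ ENNReal.ofReal_ne_top, mul_assoc]
      congr 1
      rw [Set.inter_comm, ← Measure.restrict_apply Metric.isClosed_closedBall.measurableSet,
        mul_comm, ← lintegral_indicator_const Metric.isClosed_closedBall.measurableSet]
      refine lintegral_congr fun x => ?_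
      by_cases h : dist w x ≤ R * s
      · rw [Set.indicator_of_mem (by exact h), Set.indicator_of_mem]
        rwa [Metric.mem_closedBall, dist_comm]
      · rw [Set.indicator_of_notMem (by exact h), Set.indicator_of_notMem]
        rwa [Metric.mem_closedBall, dist_comm]
    · refine Measurable.mul (by fun_prop) ?_
      have hm : MeasurableSet {q : ℝ × Euc n | q.2 ∈ F ∧ dist q.2 w ≤ R * q.1} :=
        (measurable_snd hF).inter
          (measurableSet_le (f := fun q : ℝ × Euc n => dist q.2 w) (by fun_prop) (by fun_prop))
      exact measurable_measure_prodMk_left hm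
  refine (lintegral_mono h3).trans ?_
  rw [lintegral_const_mul _ hgm, hg, lintegral_indicator hU.measurableSet]

/-- The weak-type Poincaré–Sobolev inequality on a ball. -/
lemma exists_lintegral_enorm_sub_le_ball {n : ℕ} (hn : 2 ≤ n) {ρ : ℝ} (hρ : 0 < ρ) :
    ∃ C : ENNReal, C ≠ ⊤ ∧ ∀ v : Euc n → ℝ, ContDiffOn ℝ 1 v (Metric.ball 0 ρ) →
      ∃ c : ℝ, ∀ F : Set (Euc n), MeasurableSet F → F ⊆ Metric.ball 0 ρ →
        ∫⁻ x in F, ‖v x - c‖ₑ ≤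
          C * volume F ^ (1 / (n : ℝ)) * ∫⁻ x in Metric.ball 0 ρ, ‖fderiv ℝ v x‖ₑ := by
  -- Averaging over the half ball keeps `v` integrable: its closure is a compact subset of the ball
  -- on which `v` is assumed smooth.
  set B : Set (Euc n) := Metric.ball 0 (ρ / 2) with hB
  have hB0 : volume B ≠ 0 := (Metric.measure_ball_pos _ _ (by positivity)).ne'
  have hBtop : volume B ≠ ⊤ := measure_ball_lt_top.ne
  refine ⟨(volume B)⁻¹ * (ENNReal.ofReal (2 * ρ) * (ENNReal.ofReal ((2 * ρ) ^ (n - 1)) *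
    (volume (Metric.closedBall (0 : Euc n) 1) + 1))), ?_, fun v hv => ?_⟩
  · have := measure_closedBall_lt_top (μ := (volume : Measure (Euc n))) (x := 0) (r := 1)
    finiteness
  refine ⟨⨍ y in B, v y, fun F hF hFB => ?_⟩
  have hint : IntegrableOn v B := by
    refine (ContinuousOn.integrableOn_compact (isCompact_closedBall (0 : Euc n) (ρ / 2)) ?_).mono_set
      Metric.ball_subset_closedBall
    exact hv.continuousOn.mono (Metric.closedBall_subset_ball (by linarith))
  have key : ∀ x ∈ F, ‖v x - ⨍ y in B, v y‖ₑ ≤ (volume B)⁻¹ * (ENNReal.ofReal (2 * ρ) *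
      segmentPotential (fun w => ‖fderiv ℝ v w‖ₑ) (Metric.ball 0 ρ) (2 * ρ) x) := by
    intro x hx
    have hxB : ∀ y ∈ B, segment ℝ x y ⊆ Metric.ball (0 : Euc n) ρ ∧ dist y x ≤ 2 * ρ := by
      intro y hy
      have hy' : y ∈ Metric.ball (0 : Euc n) ρ := Metric.ball_subset_ball (by linarith) hy
      refine ⟨(convex_ball (0 : Euc n) ρ).segment_subset (hFB hx) hy', ?_⟩
      have h1 := Metric.mem_ball.1 (hFB hx)
      have h2 := Metric.mem_ball.1 hy'
      linarith [dist_triangle_right y x (0 : Euc n)]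
    have h := lintegral_enorm_sub_le_segmentPotential Metric.isOpen_ball hv
      Metric.isOpen_ball.measurableSet hxB
    refine le_trans ?_ (mul_le_mul_right h _)
    have hconst : v x - ⨍ y in B, v y = ⨍ y in B, (v x - v y) := by
      rw [setAverage_eq, setAverage_eq, integral_sub (integrable_const_iff.2 (Or.inr ⟨by simpa using hBtop.lt_top⟩)) hint,
        setIntegral_const, smul_sub, smul_smul, inv_mul_cancel₀, one_smul]
      exact (ENNReal.toReal_pos hB0 hBtop).ne'
    rw [hconst, setAverage_eq, enorm_smul]
    gcongr
    · rw [enorm_inv, measureReal_def, Real.enorm_of_nonneg ENNReal.toReal_nonneg,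
        ENNReal.ofReal_toReal hBtop]
      exact (ENNReal.toReal_pos hB0 hBtop).ne'
    · exact enorm_integral_le_lintegral_enorm _
  have hfin : (volume B)⁻¹ ≠ ⊤ := ENNReal.inv_ne_top.2 hB0
  calc _ ≤ ∫⁻ x in F, (volume B)⁻¹ * (ENNReal.ofReal (2 * ρ) *
        segmentPotential (fun w => ‖fderiv ℝ v w‖ₑ) (Metric.ball 0 ρ) (2 * ρ) x) :=
        setLIntegral_mono_ae' hF (ae_of_all _ key)
    _ ≤ _ := by
      rw [lintegral_const_mul' _ _ hfin, lintegral_const_mul' _ _ ENNReal.ofReal_ne_top]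
      simp only [mul_assoc]
      gcongr
      have := lintegral_segmentPotential_le hn (R := 2 * ρ) (by positivity)
        (Metric.isOpen_ball (x := (0 : Euc n)) (ε := ρ)) v hF
      simpa only [mul_assoc] using this

/-! ### From a thin tube to a thicker one -/

/-- A weak-type bound `∫_F f ≤ K |F|^θ` on all sets `F` self-improves to bounded densities. -/
lemma lintegral_density_mul_le {α : Type*} [MeasurableSpace α] {μ : Measure α} {V : Set α}
    (hV : MeasurableSet V) (hVfin : μ V ≠ ⊤) {f h : α → ENNReal} (hf : Measurable f)
    (hh : Measurable h)
    {θ : ℝ} (hθ : 0 < θ) (hθ1 : θ < 1) {K H a : ENNReal} (hH : ∀ x, h x ≤ H)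
    (hHtop : H ≠ ⊤) (ha : ∫⁻ x in V, h x ∂μ ≤ a)
    (hK : ∀ F ⊆ V, MeasurableSet F → ∫⁻ x in F, f x ∂μ ≤ K * μ F ^ θ) :
    ∫⁻ x in V, h x * f x ∂μ ≤ (H + 1) * K * a ^ θ := by
  have hsimple : ∀ F ⊆ V, MeasurableSet F →
      ∫⁻ x in F, h x * f x ∂μ ≤ H * (K * μ F ^ θ) := fun F hF hFm => by
    calc _ ≤ ∫⁻ x in F, H * f x ∂μ := lintegral_mono fun x => mul_le_mul_left (hH x) _
      _ = H * ∫⁻ x in F, f x ∂μ := lintegral_const_mul' _ _ hHtop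
      _ ≤ _ := by gcongr; exact hK F hF hFm
  rcases eq_or_ne a 0 with rfl | ha0
  · have h0 : ∫⁻ x in V, h x ∂μ = 0 := le_antisymm ha zero_le
    have h1 := (lintegral_eq_zero_iff hh).1 h0
    have : ∫⁻ x in V, h x * f x ∂μ = 0 := by
      refine (lintegral_eq_zero_iff (hh.mul hf)).2 ?_
      filter_upwards [h1] with x hx
      simp [hx]
    simp [this]
  rcases eq_or_ne K 0 with rfl | hK0
  · refine (hsimple V subset_rfl hV).trans ?_
    simp
  rcases eq_or_ne a ⊤ with rfl | hatop
  · rw [ENNReal.top_rpow_of_pos hθ, ENNReal.mul_top]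
    · exact le_top
    · exact mul_ne_zero (by simp) hK0
  rcases eq_or_ne K ⊤ with rfl | hKtop
  · rw [ENNReal.mul_top (by simp), ENNReal.top_mul]
    · exact le_top
    · simp [ENNReal.rpow_eq_zero_iff, ha0, hatop]
  -- This level satisfies `t a = K a^θ`, and on `G = {f > t}` the bound `t |G| ≤ K |G|^θ` forces
  -- `|G| ≤ a`. On `G` one uses `h ≤ H` and the weak bound; off `G`, `f ≤ t` and `∫ h ≤ a`.
  set t : ENNReal := K * a ^ (θ - 1) with ht
  set G : Set α := V ∩ {x | t < f x} with hG
  have hGm : MeasurableSet G := hV.inter (measurableSet_lt measurable_const hf)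
  have hGfin : μ G ≠ ⊤ := ((measure_mono Set.inter_subset_left).trans_lt hVfin.lt_top).ne
  have hGa : μ G ≤ a := by
    rcases eq_or_ne (μ G) 0 with h0 | h0
    · rw [h0]; exact zero_le
    have h1 : t * μ G ≤ K * μ G ^ θ := by
      refine le_trans ?_ (hK G Set.inter_subset_left hGm)
      rw [← setLIntegral_const]
      exact setLIntegral_mono_ae' hGm (ae_of_all _ fun x hx => hx.2.le)
    rw [ht, mul_assoc, ENNReal.mul_le_mul_iff_right hK0 hKtop] at h1
    have h2 : μ G ^ (1 - θ) ≤ a ^ (1 - θ) := by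
      calc μ G ^ (1 - θ) = (a ^ (1 - θ) * a ^ (θ - 1)) * (μ G ^ (-θ) * μ G) := by
            rw [← ENNReal.rpow_add _ _ ha0 hatop]
            have : 1 - θ + (θ - 1) = 0 := by ring
            rw [this, ENNReal.rpow_zero, one_mul]
            conv_rhs => rw [← ENNReal.rpow_one (μ G), ← ENNReal.rpow_mul, one_mul,
              ← ENNReal.rpow_add _ _ h0 hGfin]
            congr 1; ring
        _ = a ^ (1 - θ) * μ G ^ (-θ) * (a ^ (θ - 1) * μ G) := by ring
        _ ≤ a ^ (1 - θ) * μ G ^ (-θ) * μ G ^ θ := by gcongr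
        _ = a ^ (1 - θ) := by
            rw [mul_assoc, ← ENNReal.rpow_add _ _ h0 hGfin]
            simp
    exact (ENNReal.rpow_le_rpow_iff (by linarith)).1 h2
  have hat : t * a = K * a ^ θ := by
    rw [ht, mul_assoc]
    congr 1
    conv_lhs => rw [← ENNReal.rpow_one a, ← ENNReal.rpow_mul, one_mul,
      ← ENNReal.rpow_add _ _ ha0 hatop]
    congr 1; ring
  have hsplit : V = G ∪ (V \ G) := (Set.union_sdiff_cancel Set.inter_subset_left).symm
  calc ∫⁻ x in V, h x * f x ∂μ
      ≤ (∫⁻ x in G, h x * f x ∂μ) + ∫⁻ x in V \ G, h x * f x ∂μ := by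
        conv_lhs => rw [hsplit]
        exact lintegral_union_le _ _ _
    _ ≤ H * (K * a ^ θ) + K * a ^ θ := by
        gcongr
        · refine (hsimple G Set.inter_subset_left hGm).trans ?_
          gcongr
        · rw [← hat]
          calc _ ≤ ∫⁻ x in V \ G, t * h x ∂μ := by
                refine setLIntegral_mono_ae' (hV.diff hGm) (ae_of_all _ fun x hx => ?_)
                rw [mul_comm]
                gcongr
                by_contra hlt
                exact hx.2 ⟨hx.1, not_le.1 hlt⟩
            _ ≤ ∫⁻ x in V, t * h x ∂μ := lintegral_mono_set Set.sdiff_subset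
            _ ≤ _ := by
                rw [lintegral_const_mul _ hh]
                gcongr
    _ = _ := by ring

lemma isOpen_tube {n : ℕ} (S : Set (Euc n)) (r : ℝ) : IsOpen (tube S r) :=
  isOpen_lt (Metric.continuous_infDist_pt S) continuous_const

lemma mem_tube_iff {n : ℕ} {S : Set (Euc n)} (hS : S.Nonempty) {r : ℝ} {x : Euc n} :
    x ∈ tube S r ↔ ∃ p ∈ S, dist x p < r :=
  Metric.infDist_lt_iff hS

lemma tube_mono {n : ℕ} (S : Set (Euc n)) {r r' : ℝ} (h : r ≤ r') : tube S r ⊆ tube S r' :=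
  fun _ hx => lt_of_lt_of_le hx h

lemma volume_tube_ne_top {n : ℕ} {S : Set (Euc n)} (hS : S.Nonempty) (hSb : Bornology.IsBounded S)
    (r : ℝ) : volume (tube S r) ≠ ⊤ := by
  refine (Bornology.IsBounded.measure_lt_top (hSb.thickening (δ := r)|>.subset ?_)).ne
  intro x hx
  rw [Metric.mem_thickening_iff]
  exact (mem_tube_iff hS).1 hx

lemma volume_ball_mul {n : ℕ} (x : Euc n) {r : ℝ} (hr : 0 < r) :
    volume (Metric.ball x r) = ENNReal.ofReal (r ^ n) * volume (Metric.ball (0 : Euc n) 1) := by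
  rw [Measure.addHaar_ball_of_pos _ _ hr]; simp

/-- For `x` in the large tube pick `p ∈ S` with `x ∈ B(p, r)` and average `|u x - k| ≤ |u x - u y| +
|u y - k|` over `y ∈ B(p, c r)`. The first term is a segment potential inside the convex ball `B(p,
r)`. The second, integrated over `F`, is a weighted integral of `|u - k|` over the thin tube, with
bounded weight of total mass `O(|F|)`, so `lintegral_density_mul_le` applies. -/
lemma exists_lintegral_tube_le {n : ℕ} (hn : 2 ≤ n) {S : Set (Euc n)} (hS : S.Nonempty)
    (hSb : Bornology.IsBounded S) {c : ℝ} (hc : 0 < c) (hc1 : c ≤ 1) :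
    ∃ C : ENNReal, C ≠ ⊤ ∧ ∀ r : ℝ, 0 < r → ∀ u : Euc n → ℝ, ContDiff ℝ 1 u → ∀ k : ℝ,
      ∀ K : ENNReal, (∀ F ⊆ tube S (c * r), MeasurableSet F →
        ∫⁻ x in F, ‖u x - k‖ₑ ≤ K * volume F ^ (1 / (n : ℝ))) →
      ∀ F ⊆ tube S r, MeasurableSet F → ∫⁻ x in F, ‖u x - k‖ₑ ≤
        C * (K + ∫⁻ x in tube S r, ‖fderiv ℝ u x‖ₑ) * volume F ^ (1 / (n : ℝ)) := by
  set ω := volume (Metric.closedBall (0 : Euc n) 1) with hω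
  set β := volume (Metric.ball (0 : Euc n) 1) with hβ
  have hβ0 : β ≠ 0 := (Metric.measure_ball_pos _ _ one_pos).ne'
  have hβtop : β ≠ ⊤ := measure_ball_lt_top.ne
  have hωtop : ω ≠ ⊤ := measure_closedBall_lt_top.ne
  set H : ENNReal := ENNReal.ofReal ((2 / c) ^ n) with hH
  set C₁ : ENNReal := H * (β⁻¹ * (ω + 1)) with hC₁
  set C₂ : ENNReal := (H + 1) * H ^ (1 / (n : ℝ)) with hC₂
  have hn1 : (1 : ℝ) < n := by exact_mod_cast (by lia : 1 < n)
  have hθ : 0 < 1 / (n : ℝ) := by positivity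
  have hθ1 : 1 / (n : ℝ) < 1 := (div_lt_one (by linarith)).2 hn1
  refine ⟨C₁ + C₂, ?_, fun r hr u hu k K hK F hFs hF => ?_⟩
  · have : β⁻¹ ≠ ⊤ := ENNReal.inv_ne_top.2 hβ0
    have h2 : H ^ (1 / (n : ℝ)) ≠ ⊤ := ENNReal.rpow_ne_top_of_nonneg hθ.le ENNReal.ofReal_ne_top
    rw [hC₁, hC₂]
    finiteness
  set V := tube S (c * r) with hV
  set f : Euc n → ENNReal := fun x => ‖u x - k‖ₑ with hf
  have hfm : Measurable f := (hu.continuous.measurable.sub_const k).enorm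
  set b : ENNReal := ENNReal.ofReal ((c * r) ^ n) * β with hb
  have hb0 : b ≠ 0 := mul_ne_zero (by simpa using pow_pos (mul_pos hc hr) n) hβ0
  have hbtop : b ≠ ⊤ := ENNReal.mul_ne_top ENNReal.ofReal_ne_top hβtop
  have hbH : b⁻¹ * (ENNReal.ofReal ((2 * r) ^ n) * β) = H := by
    have : ENNReal.ofReal ((2 * r) ^ n) * β = H * b := by
      rw [hH, hb, ← mul_assoc, ← ENNReal.ofReal_mul (by positivity), ← mul_pow]
      congr 3
      field_simp
    rw [this, mul_comm H, ← mul_assoc, ENNReal.inv_mul_cancel hb0 hbtop, one_mul]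
  have hu1 : ContDiffOn ℝ 1 u (tube S r) := hu.contDiffOn
  have key : ∀ x ∈ F, f x ≤ b⁻¹ * (ENNReal.ofReal (2 * r) *
      segmentPotential (fun w => ‖fderiv ℝ u w‖ₑ) (tube S r) (2 * r) x) +
      b⁻¹ * ∫⁻ y in V, (Metric.ball x (2 * r)).indicator f y := by
    intro x hx
    obtain ⟨p, hpS, hxp⟩ := (mem_tube_iff hS).1 (hFs hx)
    have hBr : Metric.ball p r ⊆ tube S r := fun y hy => (mem_tube_iff hS).2 ⟨p, hpS, hy⟩
    have hcr : c * r ≤ r := by nlinarith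
    set B := Metric.ball p (c * r) with hB
    have hBV : B ⊆ V := fun y hy => (mem_tube_iff hS).2 ⟨p, hpS, hy⟩
    have hvolB : volume B = b := volume_ball_mul p (by positivity)
    have hBx : ∀ y ∈ B, dist y x < 2 * r := fun y hy => by
      have h1 : dist y p < c * r := hy
      linarith [dist_triangle_right y x p]
    have hxB : ∀ y ∈ B, segment ℝ x y ⊆ tube S r ∧ dist y x ≤ 2 * r := fun y hy =>
      ⟨((convex_ball p r).segment_subset hxp (Metric.ball_subset_ball hcr hy)).trans hBr,
        (hBx y hy).le⟩
    have h1 := lintegral_enorm_sub_le_segmentPotential (isOpen_tube S r) hu1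
      Metric.isOpen_ball.measurableSet hxB
    have h2 : ∫⁻ y in B, f y ≤ ∫⁻ y in V, (Metric.ball x (2 * r)).indicator f y := by
      refine le_trans ?_ (lintegral_mono_set hBV)
      refine setLIntegral_mono_ae' Metric.isOpen_ball.measurableSet (ae_of_all _ fun y hy => ?_)
      rw [Set.indicator_of_mem (show y ∈ Metric.ball x (2 * r) from hBx y hy)]
    have h3 : b * f x ≤ (∫⁻ y in B, ‖u x - u y‖ₑ) + ∫⁻ y in B, f y := by
      rw [← lintegral_add_right _ hfm, mul_comm, ← hvolB, ← setLIntegral_const]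
      refine lintegral_mono fun y => ?_
      have : u x - k = (u x - u y) + (u y - k) := by ring
      simp only [hf]
      rw [this]
      exact enorm_add_le _ _
    calc f x = b⁻¹ * (b * f x) := by
          rw [← mul_assoc, ENNReal.inv_mul_cancel hb0 hbtop, one_mul]
      _ ≤ b⁻¹ * (_ + _) := by
          gcongr
          exact h3.trans (add_le_add h1 h2)
      _ = _ := mul_add _ _ _
  have hbinv : b⁻¹ ≠ ⊤ := ENNReal.inv_ne_top.2 hb0
  have hballm : MeasurableSet {q : Euc n × Euc n | dist q.2 q.1 < 2 * r} :=
    measurableSet_lt (by fun_prop) (by fun_prop)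
  have hjoint : Measurable fun q : Euc n × Euc n =>
      (Metric.ball q.1 (2 * r)).indicator f q.2 := by
    have : (fun q : Euc n × Euc n => (Metric.ball q.1 (2 * r)).indicator f q.2) =
        {q : Euc n × Euc n | dist q.2 q.1 < 2 * r}.indicator (fun q => f q.2) := rfl
    rw [this]
    exact (hfm.comp measurable_snd).indicator hballm
  have hsecond : ∫⁻ x in F, b⁻¹ * ∫⁻ y in V, (Metric.ball x (2 * r)).indicator f y ≤
      C₂ * K * volume F ^ (1 / (n : ℝ)) := by
    -- The weight that `y` receives when the order of integration over `x ∈ F` and `y ∈ B(x, 2r)` is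
    -- exchanged. Replacing `B(p, c r)` by `B(x, 2r)` avoids a measurable choice of `p`.
    set h : Euc n → ENNReal := fun y => b⁻¹ * volume (F ∩ Metric.ball y (2 * r)) with hh
    have hset : MeasurableSet {q : Euc n × Euc n | q.2 ∈ F ∧ dist q.2 q.1 < 2 * r} :=
      (measurable_snd hF).inter hballm
    have hhm : Measurable h := (measurable_measure_prodMk_left hset).const_mul _
    have hhH : ∀ y, h y ≤ H := fun y => by
      rw [← hbH, ← volume_ball_mul y (by positivity)]
      simp only [hh]
      gcongr
      exact Set.inter_subset_right
    have hha : ∫⁻ y in V, h y ≤ H * volume F := by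
      calc ∫⁻ y in V, h y ≤ ∫⁻ y, h y := setLIntegral_le_lintegral _ _
        _ = b⁻¹ * ∫⁻ y, ∫⁻ x in F, (Metric.ball y (2 * r)).indicator (fun _ => 1) x := by
            rw [← lintegral_const_mul' _ _ hbinv]
            refine lintegral_congr fun y => ?_
            rw [lintegral_indicator Metric.isOpen_ball.measurableSet, setLIntegral_one,
              Measure.restrict_apply Metric.isOpen_ball.measurableSet, Set.inter_comm]
        _ = b⁻¹ * ∫⁻ x in F, ∫⁻ y, (Metric.ball y (2 * r)).indicator (fun _ => 1) x := by
            rw [lintegral_lintegral_swap]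
            refine Measurable.aemeasurable ?_
            exact (measurable_const (a := (1 : ENNReal))).indicator hballm
        _ = b⁻¹ * ∫⁻ x in F, ENNReal.ofReal ((2 * r) ^ n) * β := by
            congr 1
            refine lintegral_congr fun x => ?_
            rw [← volume_ball_mul x (by positivity : 0 < 2 * r),
              ← lintegral_indicator_one Metric.isOpen_ball.measurableSet]
            refine lintegral_congr fun y => ?_
            by_cases hd : dist x y < 2 * r
            · rw [Set.indicator_of_mem (by exact hd), Set.indicator_of_mem]
              · rfl
              · rwa [Metric.mem_ball, dist_comm]
            · rw [Set.indicator_of_notMem (by exact hd), Set.indicator_of_notMem]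
              rwa [Metric.mem_ball, dist_comm]
        _ = _ := by rw [setLIntegral_const, ← mul_assoc, hbH]
    have hfinal := lintegral_density_mul_le (isOpen_tube S (c * r)).measurableSet
      (volume_tube_ne_top hS hSb _) hfm hhm hθ hθ1 hhH ENNReal.ofReal_ne_top hha hK
    calc _ = b⁻¹ * ∫⁻ y in V, ∫⁻ x in F, (Metric.ball x (2 * r)).indicator f y := by
          rw [lintegral_const_mul' _ _ hbinv, lintegral_lintegral_swap hjoint.aemeasurable]
      _ = ∫⁻ y in V, h y * f y := by
          rw [← lintegral_const_mul' _ _ hbinv]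
          refine lintegral_congr fun y => ?_
          rw [show h y = b⁻¹ * volume (F ∩ Metric.ball y (2 * r)) from rfl, mul_assoc]
          congr 1
          rw [Set.inter_comm, ← Measure.restrict_apply Metric.isOpen_ball.measurableSet,
            mul_comm (volume.restrict F _), ← lintegral_indicator_const Metric.isOpen_ball.measurableSet]
          refine lintegral_congr fun x => ?_
          by_cases hd : dist y x < 2 * r
          · rw [Set.indicator_of_mem (by exact hd), Set.indicator_of_mem]
            rwa [Metric.mem_ball, dist_comm]
          · rw [Set.indicator_of_notMem (by exact hd), Set.indicator_of_notMem]
            rwa [Metric.mem_ball, dist_comm]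
      _ ≤ _ := hfinal
      _ = _ := by
          rw [ENNReal.mul_rpow_of_nonneg _ _ hθ.le, hC₂]
          ring
  have hfirst : ∫⁻ x in F, b⁻¹ * (ENNReal.ofReal (2 * r) *
      segmentPotential (fun w => ‖fderiv ℝ u w‖ₑ) (tube S r) (2 * r) x) ≤
      C₁ * (∫⁻ x in tube S r, ‖fderiv ℝ u x‖ₑ) * volume F ^ (1 / (n : ℝ)) := by
    rw [lintegral_const_mul' _ _ hbinv, lintegral_const_mul' _ _ ENNReal.ofReal_ne_top]
    have h := lintegral_segmentPotential_le hn (R := 2 * r) (by positivity) (isOpen_tube S r) u hF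
    refine (mul_le_mul_right (mul_le_mul_right h _) _).trans (le_of_eq ?_)
    have e1 : C₁ = b⁻¹ * (ENNReal.ofReal (2 * r) * (ENNReal.ofReal ((2 * r) ^ (n - 1)) *
        (ω + 1))) := by
      rw [hC₁, ← hbH, ← mul_assoc (ENNReal.ofReal (2 * r)), ← ENNReal.ofReal_mul (by positivity),
        mul_pow_sub_one (by lia)]
      have : β * β⁻¹ = 1 := ENNReal.mul_inv_cancel hβ0 hβtop
      calc _ = b⁻¹ * ENNReal.ofReal ((2 * r) ^ n) * (β * β⁻¹) * (ω + 1) := by ring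
        _ = _ := by rw [this]; ring
    rw [e1]
    ring
  calc _ ≤ ∫⁻ x in F, (b⁻¹ * (ENNReal.ofReal (2 * r) *
      segmentPotential (fun w => ‖fderiv ℝ u w‖ₑ) (tube S r) (2 * r) x) +
      b⁻¹ * ∫⁻ y in V, (Metric.ball x (2 * r)).indicator f y) :=
        setLIntegral_mono_ae' hF (ae_of_all _ key)
    _ = _ + _ := lintegral_add_right _ (hjoint.lintegral_prod_right'.const_mul _)
    _ ≤ _ := add_le_add hfirst hsecond
    _ ≤ (C₁ + C₂) * (∫⁻ x in tube S r, ‖fderiv ℝ u x‖ₑ) * volume F ^ (1 / (n : ℝ)) +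
        (C₁ + C₂) * K * volume F ^ (1 / (n : ℝ)) := by
        gcongr
        · exact le_self_add
        · exact le_add_self
    _ = _ := by ring

/-! ### Straightening charts and slabs of small thickness -/

/-- The linear map multiplying the component along the unit vector `ν` by `s` and fixing `νᗮ`. -/
noncomputable def flatten {n : ℕ} (ν : Euc n) (s : ℝ) : Euc n →L[ℝ] Euc n :=
  ContinuousLinearMap.id ℝ (Euc n) + (innerSL ℝ ν).smulRight ((s - 1) • ν)

section flatten

variable {n : ℕ} {ν : Euc n}

lemma flatten_apply (s : ℝ) (y : Euc n) :
    flatten ν s y = y + (inner ℝ ν y * (s - 1)) • ν := by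
  simp [flatten, smul_smul]

lemma inner_flatten (hν : ‖ν‖ = 1) (s : ℝ) (y : Euc n) :
    inner ℝ ν (flatten ν s y) = s * inner ℝ ν y := by
  rw [flatten_apply, inner_add_right, inner_smul_right, real_inner_self_eq_norm_sq, hν]
  ring

lemma flatten_flatten_inv (hν : ‖ν‖ = 1) {s : ℝ} (hs : s ≠ 0) (y : Euc n) :
    flatten ν s (flatten ν s⁻¹ y) = y := by
  rw [flatten_apply s, inner_flatten hν, flatten_apply, add_assoc, ← add_smul]
  have : inner ℝ ν y * (s⁻¹ - 1) + s⁻¹ * inner ℝ ν y * (s - 1) = 0 := by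
    field_simp
    ring
  rw [this, zero_smul, add_zero]

lemma flatten_inv_flatten (hν : ‖ν‖ = 1) {s : ℝ} (hs : s ≠ 0) (y : Euc n) :
    flatten ν s⁻¹ (flatten ν s y) = y := by
  simpa using flatten_flatten_inv hν (inv_ne_zero hs) y

lemma norm_flatten_le (hν : ‖ν‖ = 1) {s : ℝ} (hs : 0 ≤ s) (hs1 : s ≤ 1) (y : Euc n) :
    ‖flatten ν s y‖ ≤ ‖y‖ := by
  have h1 : ‖flatten ν s y‖ ^ 2 = ‖y‖ ^ 2 - (1 - s ^ 2) * (inner ℝ ν y) ^ 2 := by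
    rw [flatten_apply, norm_add_sq_real, inner_smul_right, norm_smul, hν, real_inner_comm,
      mul_one, Real.norm_eq_abs, sq_abs]
    ring
  have h2 : 0 ≤ (1 - s ^ 2) * (inner ℝ ν y) ^ 2 := by
    have : s ^ 2 ≤ 1 := pow_le_one₀ hs hs1
    have := sq_nonneg (inner ℝ ν y)
    exact mul_nonneg (by linarith) this
  exact le_of_sq_le_sq (by linarith) (norm_nonneg y)

lemma det_flatten (hν : ‖ν‖ = 1) (s : ℝ) : (flatten ν s).det = s := by
  have : (flatten ν s : Euc n →ₗ[ℝ] Euc n) =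
      LinearMap.transvection (innerSL ℝ ν : Euc n →ₗ[ℝ] ℝ) ((s - 1) • ν) := by
    ext1 y
    simp [flatten, LinearMap.transvection]
  rw [ContinuousLinearMap.det, this, LinearMap.transvection.det]
  simp [hν]

lemma norm_flatten_sub_flatten_zero (hν : ‖ν‖ = 1) {s : ℝ} (hs : 0 ≤ s) (y : Euc n) :
    ‖flatten ν s y - flatten ν 0 y‖ = s * |inner ℝ ν y| := by
  rw [flatten_apply, flatten_apply, add_sub_add_left_eq_sub, ← sub_smul, norm_smul, hν, mul_one]
  have : inner ℝ ν y * (s - 1) - inner ℝ ν y * (0 - 1) = s * inner ℝ ν y := by ring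
  rw [this, Real.norm_eq_abs, abs_mul, abs_of_nonneg hs]

lemma norm_flatten_inv_le (hν : ‖ν‖ = 1) {s : ℝ} (hs : 0 < s) (hs1 : s ≤ 1) (y : Euc n) :
    ‖flatten ν s⁻¹ y‖ ≤ ‖y‖ + s⁻¹ * |inner ℝ ν y| := by
  rw [flatten_apply]
  refine (norm_add_le _ _).trans ?_
  rw [norm_smul, hν, mul_one, Real.norm_eq_abs, abs_mul, mul_comm]
  have h1 : 1 ≤ s⁻¹ := (one_le_inv₀ hs).2 hs1
  rw [abs_of_nonneg (by linarith)]
  gcongr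
  linarith

end flatten

/-- A `C¹` parametrization of a neighbourhood of `z`, close to an isometry, which straightens `S`
to the hyperplane orthogonal to `normal`. -/
structure StraighteningChart {n : ℕ} (S : Set (Euc n)) (z : Euc n) where
  /-- the parametrization -/
  toFun : Euc n → Euc n
  /-- the unit normal of the straightened hypersurface -/
  normal : Euc n
  /-- the radius of the ball on which the parametrization is controlled -/
  radius : ℝ
  norm_normal : ‖normal‖ = 1
  radius_pos : 0 < radius
  contDiffOn : ContDiffOn ℝ 1 toFun (Metric.ball 0 radius)
  expand : ∀ y ∈ Metric.ball (0 : Euc n) radius, ∀ y' ∈ Metric.ball (0 : Euc n) radius,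
    ‖y - y'‖ ≤ 2 * ‖toFun y - toFun y'‖
  lipschitz : ∀ y ∈ Metric.ball (0 : Euc n) radius, ∀ y' ∈ Metric.ball (0 : Euc n) radius,
    ‖toFun y - toFun y'‖ ≤ 2 * ‖y - y'‖
  half_le_det : ∀ y ∈ Metric.ball (0 : Euc n) radius, 1 / 2 ≤ |(fderiv ℝ toFun y).det|
  det_le_two : ∀ y ∈ Metric.ball (0 : Euc n) radius, |(fderiv ℝ toFun y).det| ≤ 2
  map_zero : toFun 0 = z
  mem_iff : ∀ y ∈ Metric.ball (0 : Euc n) radius, toFun y ∈ S ↔ inner ℝ normal y = 0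
  image_mem_nhds : ∀ m, 0 < m → m ≤ radius → toFun '' Metric.ball 0 m ∈ nhds z

-- The inverse function theorem applied to the map that replaces the normal coordinate of `x - z` by
-- `f x / |∇f(z)|`. Its derivative at `z` is the identity, so on a small ball the inverse is nearly
-- an isometry, and it carries a hyperplane to the zero set of `f`.
open Topology in
theorem exists_straighteningChart {n : ℕ} {S : Set (Euc n)} {z : Euc n} (hz : z ∈ S)
    {f : Euc n → ℝ} (hf : IsLocalDefiningFunction S z f) : Nonempty (StraighteningChart S z) := by
  obtain ⟨V, hVo, hzV, hfV, hgrad, hSV⟩ := hf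
  have hfz : f z = 0 := by
    have : z ∈ S ∩ V := ⟨hz, hzV⟩
    rw [hSV] at this
    exact this.2
  set G := gradient f z with hG
  have hG0 : 0 < ‖G‖ := norm_pos_iff.2 (hgrad z hzV)
  set ν : Euc n := ‖G‖⁻¹ • G with hν
  have hν1 : ‖ν‖ = 1 := by
    rw [hν, norm_smul, norm_inv, norm_norm, inv_mul_cancel₀ hG0.ne']
  have hfc : ContDiffAt ℝ 1 f z := (hfV.contDiffAt (hVo.mem_nhds hzV)).of_le (by norm_num)
  have hfd : HasFDerivAt f (innerSL ℝ G) z :=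
    ((hfc.differentiableAt one_ne_zero).hasGradientAt).hasFDerivAt
  set Φ : Euc n → Euc n := fun x => (x - z) + (‖G‖⁻¹ * f x - inner ℝ ν (x - z)) • ν with hΦ
  have hΦc : ContDiffAt ℝ 1 Φ z := by
    have : ContDiffAt ℝ 1 (fun x => inner ℝ ν (x - z)) z :=
      contDiffAt_const.inner ℝ (by fun_prop)
    exact (by fun_prop : ContDiffAt ℝ 1 (fun x : Euc n => x - z) z).add
      (((contDiffAt_const.mul hfc).sub this).smul contDiffAt_const)
  have hΦd : HasFDerivAt Φ (ContinuousLinearEquiv.refl ℝ (Euc n) : Euc n →L[ℝ] Euc n) z := by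
    have h1 : HasFDerivAt (fun x => x - z) (ContinuousLinearMap.id ℝ (Euc n)) z :=
      (hasFDerivAt_id z).sub_const z
    have h2 : HasFDerivAt (fun x => inner ℝ ν (x - z)) (innerSL ℝ ν) z :=
      ((innerSL ℝ ν).hasFDerivAt.comp z h1)
    have h3 := h1.add (((hfd.const_mul ‖G‖⁻¹).sub h2).smul_const ν)
    convert! h3 using 1
    ext1 h
    simp [hν]
  have hΦz : Φ z = 0 := by simp [hΦ, hfz]
  have hinner : ∀ x, inner ℝ ν (Φ x) = ‖G‖⁻¹ * f x := fun x => by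
    simp only [hΦ]
    rw [inner_add_right, inner_smul_right, real_inner_self_eq_norm_sq, hν1]
    ring
  set e := hΦc.toOpenPartialHomeomorph Φ hΦd one_ne_zero with he
  have hze : z ∈ e.source := hΦc.mem_toOpenPartialHomeomorph_source hΦd one_ne_zero
  have hez : e z = 0 := hΦz
  have h0e : (0 : Euc n) ∈ e.target := hez ▸ e.map_source hze
  set Ψ : Euc n → Euc n := fun y => e.symm y with hΨ
  have hΨ0 : Ψ 0 = z := by
    simp only [hΨ]
    rw [← hez, e.left_inv hze]
  have hΨc : ContDiffAt ℝ 1 Ψ 0 := by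
    have := hΦc.to_localInverse hΦd one_ne_zero
    rwa [hΦz] at this
  have hΨd : HasStrictFDerivAt Ψ (ContinuousLinearMap.id ℝ (Euc n)) 0 := by
    have h1 : HasFDerivAt e.symm
        ((ContinuousLinearEquiv.refl ℝ (Euc n)).symm : Euc n →L[ℝ] Euc n) 0 := by
      apply e.hasFDerivAt_symm h0e
      have h2 : e.symm 0 = z := hΨ0
      rw [h2]
      exact hΦd
    exact hΨc.hasStrictFDerivAt' h1 one_ne_zero
  -- Deviation at most `1/2` from the identity yields both Lipschitz bounds with constant `2`.
  obtain ⟨N₁, hN₁, happrox⟩ := hΨd.approximates_deriv_on_nhds (c := 1 / 2) (Or.inr (by norm_num))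
  have hc1 : ∀ᶠ y in 𝓝 (0 : Euc n), ContDiffAt ℝ 1 Ψ y := hΨc.eventually (by simp)
  have hdetc : ContinuousAt (fun y => |(fderiv ℝ Ψ y).det|) 0 := by
    have h1 : ContinuousAt (fderiv ℝ Ψ) 0 :=
      (hΨc.fderiv_right (m := 0) (by simp)).continuousAt
    exact ((ContinuousLinearMap.continuous_det.continuousAt).comp h1).abs
  have hdet0 : |(fderiv ℝ Ψ 0).det| = 1 := by
    rw [hΨd.hasFDerivAt.fderiv]
    simp [ContinuousLinearMap.det]
  have hd1 : ∀ᶠ y in 𝓝 (0 : Euc n), 1 / 2 < |(fderiv ℝ Ψ y).det| :=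
    hdetc.eventually (lt_mem_nhds (by beta_reduce; rw [hdet0]; norm_num))
  have hd2 : ∀ᶠ y in 𝓝 (0 : Euc n), |(fderiv ℝ Ψ y).det| < 2 :=
    hdetc.eventually (gt_mem_nhds (by beta_reduce; rw [hdet0]; norm_num))
  have hV : ∀ᶠ y in 𝓝 (0 : Euc n), Ψ y ∈ V :=
    hΨc.continuousAt.eventually (by rw [hΨ0]; exact hVo.mem_nhds hzV)
  have htarget : ∀ᶠ y in 𝓝 (0 : Euc n), y ∈ e.target := e.open_target.mem_nhds h0e
  obtain ⟨ρ, hρ, hball⟩ := Metric.eventually_nhds_iff_ball.1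
    (((hc1.and hd1).and (hd2.and hV)).and (htarget.and hN₁))
  have happ : ∀ y ∈ Metric.ball (0 : Euc n) ρ, ∀ y' ∈ Metric.ball (0 : Euc n) ρ,
      ‖Ψ y - Ψ y' - (y - y')‖ ≤ 1 / 2 * ‖y - y'‖ := fun y hy y' hy' => by
    simpa using happrox y (hball y hy).2.2 y' (hball y' hy').2.2
  refine ⟨⟨Ψ, ν, ρ, hν1, hρ, fun y hy => (hball y hy).1.1.1.contDiffWithinAt, ?_, ?_,
    fun y hy => (hball y hy).1.1.2.le, fun y hy => (hball y hy).1.2.1.le, hΨ0, ?_, ?_⟩⟩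
  · intro y hy y' hy'
    have h1 := happ y hy y' hy'
    have h2 : ‖y - y'‖ ≤ ‖Ψ y - Ψ y'‖ + ‖Ψ y - Ψ y' - (y - y')‖ := by
      have := norm_sub_le (Ψ y - Ψ y') (Ψ y - Ψ y' - (y - y'))
      rwa [sub_sub_cancel] at this
    linarith
  · intro y hy y' hy'
    have h1 := happ y hy y' hy'
    have h2 : ‖Ψ y - Ψ y'‖ ≤ ‖Ψ y - Ψ y' - (y - y')‖ + ‖y - y'‖ := by
      have := norm_add_le (Ψ y - Ψ y' - (y - y')) (y - y')
      rwa [sub_add_cancel] at this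
    linarith [norm_nonneg (y - y')]
  · intro y hy
    have hΦΨ : Φ (Ψ y) = y := e.right_inv (hball y hy).2.1
    have hyV : Ψ y ∈ V := (hball y hy).1.2.2
    have h1 : Ψ y ∈ S ↔ f (Ψ y) = 0 := by
      have : Ψ y ∈ S ∩ V ↔ Ψ y ∈ {x ∈ V | f x = 0} := by rw [hSV]
      simpa [hyV] using this
    rw [h1]
    have := hinner (Ψ y)
    rw [hΦΨ] at this
    rw [this]
    simp [hG0.ne']
  · intro m hm _
    have := e.symm.map_nhds_eq (x := 0) h0e
    have h2 : e.symm 0 = z := hΨ0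
    rw [h2] at this
    rw [← this]
    exact Filter.image_mem_map (Metric.ball_mem_nhds _ hm)

namespace StraighteningChart

variable {n : ℕ} {S : Set (Euc n)} {z : Euc n} (χ : StraighteningChart S z)

/-- The chart precomposed with the flattening of the normal direction by the factor `s`. -/
noncomputable def flat (s : ℝ) (y : Euc n) : Euc n := χ.toFun (flatten χ.normal s y)

/-- The curved slab around `S` of thickness comparable to `s`. -/
def slab (s : ℝ) : Set (Euc n) := χ.flat s '' Metric.ball 0 χ.radius

lemma flatten_mem_ball {s : ℝ} (hs : 0 ≤ s) (hs1 : s ≤ 1) {ρ : ℝ} {y : Euc n}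
    (hy : y ∈ Metric.ball (0 : Euc n) ρ) :
    flatten χ.normal s y ∈ Metric.ball (0 : Euc n) ρ := by
  rw [mem_ball_zero_iff] at hy ⊢
  exact (norm_flatten_le χ.norm_normal hs hs1 y).trans_lt hy

lemma hasFDerivAt_flat {s : ℝ} (hs : 0 ≤ s) (hs1 : s ≤ 1) {y : Euc n}
    (hy : y ∈ Metric.ball (0 : Euc n) χ.radius) :
    HasFDerivAt (χ.flat s)
      ((fderiv ℝ χ.toFun (flatten χ.normal s y)).comp (flatten χ.normal s)) y := by
  have h1 := χ.flatten_mem_ball hs hs1 hy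
  have h2 : HasFDerivAt χ.toFun (fderiv ℝ χ.toFun (flatten χ.normal s y)) (flatten χ.normal s y) :=
    ((χ.contDiffOn.contDiffAt (Metric.isOpen_ball.mem_nhds h1)).differentiableAt
      one_ne_zero).hasFDerivAt
  exact h2.comp y (flatten χ.normal s).hasFDerivAt

lemma contDiffOn_flat {s : ℝ} (hs : 0 ≤ s) (hs1 : s ≤ 1) :
    ContDiffOn ℝ 1 (χ.flat s) (Metric.ball 0 χ.radius) :=
  χ.contDiffOn.comp (flatten χ.normal s).contDiff.contDiffOn
    fun _ hy => χ.flatten_mem_ball hs hs1 hy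

lemma injOn_flat {s : ℝ} (hs : 0 < s) (hs1 : s ≤ 1) :
    Set.InjOn (χ.flat s) (Metric.ball 0 χ.radius) := by
  intro y hy y' hy' h
  have h1 := χ.expand _ (χ.flatten_mem_ball hs.le hs1 hy) _ (χ.flatten_mem_ball hs.le hs1 hy')
  have h2 : χ.toFun (flatten χ.normal s y) - χ.toFun (flatten χ.normal s y') = 0 :=
    sub_eq_zero.2 h
  rw [h2, norm_zero, mul_zero] at h1
  have h3 := sub_eq_zero.1 (norm_le_zero_iff.1 h1)
  rw [← flatten_inv_flatten χ.norm_normal hs.ne' y, h3,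
    flatten_inv_flatten χ.norm_normal hs.ne' y']

lemma abs_det_flat {s : ℝ} (hs : 0 ≤ s) (y : Euc n) :
    |((fderiv ℝ χ.toFun (flatten χ.normal s y)).comp (flatten χ.normal s)).det| =
      |(fderiv ℝ χ.toFun (flatten χ.normal s y)).det| * s := by
  have : ((fderiv ℝ χ.toFun (flatten χ.normal s y)).comp (flatten χ.normal s)).det =
      (fderiv ℝ χ.toFun (flatten χ.normal s y)).det * (flatten χ.normal s).det := by
    simp only [ContinuousLinearMap.det, ContinuousLinearMap.toLinearMap_comp, LinearMap.det_comp]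
  rw [this, det_flatten χ.norm_normal, abs_mul, abs_of_nonneg hs]

lemma lintegral_image_flat {s : ℝ} (hs : 0 < s) (hs1 : s ≤ 1) {M : Set (Euc n)}
    (hM : MeasurableSet M) (hMb : M ⊆ Metric.ball 0 χ.radius) (g : Euc n → ENNReal) :
    ∫⁻ x in χ.flat s '' M, g x = ∫⁻ y in M,
      ENNReal.ofReal (|(fderiv ℝ χ.toFun (flatten χ.normal s y)).det| * s) * g (χ.flat s y) := by
  rw [lintegral_image_eq_lintegral_abs_det_fderiv_mul volume hM
    (fun _ hy => (χ.hasFDerivAt_flat hs.le hs1 (hMb hy)).hasFDerivWithinAt)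
    ((χ.injOn_flat hs hs1).mono hMb)]
  simp_rw [χ.abs_det_flat hs.le]

lemma lintegral_image_flat_le {s : ℝ} (hs : 0 < s) (hs1 : s ≤ 1) {M : Set (Euc n)}
    (hM : MeasurableSet M) (hMb : M ⊆ Metric.ball 0 χ.radius) (g : Euc n → ENNReal) :
    ∫⁻ x in χ.flat s '' M, g x ≤ 2 * ENNReal.ofReal s * ∫⁻ y in M, g (χ.flat s y) := by
  rw [χ.lintegral_image_flat hs hs1 hM hMb, ← lintegral_const_mul' _ _ (by finiteness)]
  refine setLIntegral_mono_ae' hM (ae_of_all _ fun y hy => ?_)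
  gcongr
  have := χ.det_le_two _ (χ.flatten_mem_ball hs.le hs1 (hMb hy))
  calc _ ≤ ENNReal.ofReal (2 * s) := ENNReal.ofReal_le_ofReal (by gcongr)
    _ = _ := by rw [ENNReal.ofReal_mul (by norm_num)]; simp

lemma le_lintegral_image_flat {s : ℝ} (hs : 0 < s) (hs1 : s ≤ 1) {M : Set (Euc n)}
    (hM : MeasurableSet M) (hMb : M ⊆ Metric.ball 0 χ.radius) (g : Euc n → ENNReal) :
    ENNReal.ofReal (s / 2) * ∫⁻ y in M, g (χ.flat s y) ≤ ∫⁻ x in χ.flat s '' M, g x := by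
  rw [χ.lintegral_image_flat hs hs1 hM hMb, ← lintegral_const_mul' _ _ (by finiteness)]
  refine setLIntegral_mono_ae' hM (ae_of_all _ fun y hy => ?_)
  gcongr
  have := χ.half_le_det _ (χ.flatten_mem_ball hs.le hs1 (hMb hy))
  nlinarith

lemma measurableSet_image_flat {s : ℝ} (hs : 0 < s) (hs1 : s ≤ 1) {M : Set (Euc n)}
    (hM : MeasurableSet M) (hMb : M ⊆ Metric.ball 0 χ.radius) :
    MeasurableSet (χ.flat s '' M) :=
  measurable_image_of_fderivWithin hM
    (fun _ hy => (χ.hasFDerivAt_flat hs.le hs1 (hMb hy)).hasFDerivWithinAt)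
    ((χ.injOn_flat hs hs1).mono hMb)

lemma measurableSet_slab {s : ℝ} (hs : 0 < s) (hs1 : s ≤ 1) : MeasurableSet (χ.slab s) :=
  χ.measurableSet_image_flat hs hs1 Metric.isOpen_ball.measurableSet subset_rfl

lemma volume_slab_le {s : ℝ} (hs : 0 < s) (hs1 : s ≤ 1) :
    volume (χ.slab s) ≤ 2 * volume (Metric.ball (0 : Euc n) χ.radius) * ENNReal.ofReal s := by
  have := χ.lintegral_image_flat_le hs hs1 Metric.isOpen_ball.measurableSet subset_rfl 1
  simp only [Pi.one_apply, setLIntegral_one] at this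
  rw [slab, mul_right_comm]
  exact this

/-- The comparison point in `S` is the image of the orthogonal projection `flatten χ.normal 0 y`. -/
lemma infDist_flat_le {s : ℝ} (hs : 0 ≤ s) (hs1 : s ≤ 1) {ρ : ℝ} (hρ : ρ ≤ χ.radius) {y : Euc n}
    (hy : y ∈ Metric.ball (0 : Euc n) ρ) : Metric.infDist (χ.flat s y) S ≤ 2 * s * ‖y‖ := by
  have hy' := Metric.ball_subset_ball hρ hy
  have h0 := χ.flatten_mem_ball le_rfl zero_le_one hy'
  have hS : χ.toFun (flatten χ.normal 0 y) ∈ S := by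
    rw [χ.mem_iff _ h0, inner_flatten χ.norm_normal, zero_mul]
  refine (Metric.infDist_le_dist_of_mem hS).trans ?_
  rw [dist_eq_norm]
  refine (χ.lipschitz _ (χ.flatten_mem_ball hs hs1 hy') _ h0).trans ?_
  rw [norm_flatten_sub_flatten_zero χ.norm_normal hs, mul_assoc]
  gcongr
  have := abs_real_inner_le_norm χ.normal y
  rwa [χ.norm_normal, one_mul] at this

lemma slab_subset_tube {s : ℝ} (hs : 0 < s) (hs1 : s ≤ 1) :
    χ.slab s ⊆ tube S (2 * χ.radius * s) := by
  rintro _ ⟨y, hy, rfl⟩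
  refine (χ.infDist_flat_le hs.le hs1 le_rfl hy).trans_lt ?_
  have := mem_ball_zero_iff.1 hy
  nlinarith

/-- If `x` is close to `z` and within `c s` of `q ∈ S`, the chart's expansion bound makes the normal
coordinate of the preimage of `x` smaller than `s` times half the radius. Undoing the squeeze thus
adds less than half the radius to a preimage already in the half ball. The bound `c ≤ ε / 2` keeps
`q` in the chart's range. -/
lemma exists_ball_inter_tube_subset_slab (hz : z ∈ S) : ∃ c η : ℝ, 0 < c ∧ 0 < η ∧
    ∀ s : ℝ, 0 < s → s ≤ 1 → Metric.ball z η ∩ tube S (c * s) ⊆ χ.slab s := by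
  have hρ := χ.radius_pos
  obtain ⟨ε, hε, hball⟩ := Metric.mem_nhds_iff.1
    (χ.image_mem_nhds (χ.radius / 2) (by positivity) (by linarith))
  refine ⟨min (ε / 2) (χ.radius / 4), ε / 2, by positivity, by positivity, ?_⟩
  rintro s hs hs1 x ⟨hxz, hxS⟩
  obtain ⟨q, hqS, hxq⟩ := (mem_tube_iff ⟨z, hz⟩).1 hxS
  have hc : min (ε / 2) (χ.radius / 4) * s ≤ ε / 2 := by
    have := min_le_left (ε / 2) (χ.radius / 4)
    nlinarith
  have hqz : dist q z < ε := by
    have := Metric.mem_ball.1 hxz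
    have h2 := dist_triangle_left q z x
    linarith
  obtain ⟨yx, hyx, rfl⟩ := hball (show x ∈ Metric.ball z ε from
    Metric.ball_subset_ball (by linarith) hxz)
  obtain ⟨yq, hyq, rfl⟩ := hball (show q ∈ Metric.ball z ε from hqz)
  have hsub : Metric.ball (0 : Euc n) (χ.radius / 2) ⊆ Metric.ball 0 χ.radius :=
    Metric.ball_subset_ball (by linarith)
  have hinner : inner ℝ χ.normal yq = 0 := (χ.mem_iff _ (hsub hyq)).1 hqS
  have hexp := χ.expand _ (hsub hyx) _ (hsub hyq)
  rw [← dist_eq_norm (χ.toFun yx)] at hexp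
  have hin : |inner ℝ χ.normal yx| ≤ ‖yx - yq‖ := by
    have := abs_real_inner_le_norm χ.normal (yx - yq)
    rwa [inner_sub_right, hinner, sub_zero, χ.norm_normal, one_mul] at this
  refine ⟨flatten χ.normal s⁻¹ yx, ?_, ?_⟩
  · rw [mem_ball_zero_iff]
    refine (norm_flatten_inv_le χ.norm_normal hs hs1 yx).trans_lt ?_
    have h1 : |inner ℝ χ.normal yx| < s * (χ.radius / 2) := by
      have : min (ε / 2) (χ.radius / 4) * s ≤ χ.radius / 4 * s := by
        gcongr
        exact min_le_right _ _
      linarith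
    have h2 : s⁻¹ * |inner ℝ χ.normal yx| < χ.radius / 2 := by
      rw [inv_mul_lt_iff₀ hs]
      exact h1
    have h3 := mem_ball_zero_iff.1 hyx
    linarith
  · simp only [flat]
    rw [flatten_flatten_inv χ.norm_normal hs.ne']

lemma exists_le_volume_ball_inter_tube (χ : StraighteningChart S z) {η : ℝ} (hη : 0 < η) : ∃ c : ENNReal, c ≠ 0 ∧
    ∀ s : ℝ, 0 < s → s ≤ 1 →
      c * ENNReal.ofReal s ≤ volume (Metric.ball z η ∩ tube S s) := by
  have hρ := χ.radius_pos
  -- `η / 2` keeps the image, under a map with Lipschitz constant `2`, in `B(z, η)`; `1 / 2` keeps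
  -- it within `s` of `S`.
  set ρ := min χ.radius (min (η / 2) (1 / 2)) with hρdef
  have hρpos : 0 < ρ := by positivity
  have hρ1 : ρ ≤ χ.radius := min_le_left _ _
  have hρ2 : ρ ≤ η / 2 := (min_le_right _ _).trans (min_le_left _ _)
  have hρ3 : ρ ≤ 1 / 2 := (min_le_right _ _).trans (min_le_right _ _)
  have hsub : Metric.ball (0 : Euc n) ρ ⊆ Metric.ball 0 χ.radius := Metric.ball_subset_ball hρ1
  refine ⟨ENNReal.ofReal (1 / 2) * volume (Metric.ball (0 : Euc n) ρ), ?_, fun s hs hs1 => ?_⟩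
  · exact mul_ne_zero (by simp) (Metric.measure_ball_pos _ _ hρpos).ne'
  · have h1 := χ.le_lintegral_image_flat hs hs1 Metric.isOpen_ball.measurableSet hsub 1
    simp only [Pi.one_apply, setLIntegral_one] at h1
    calc _ = ENNReal.ofReal (s / 2) * volume (Metric.ball (0 : Euc n) ρ) := by
          rw [mul_right_comm, ← ENNReal.ofReal_mul (by norm_num)]
          congr 2
          ring
      _ ≤ _ := h1
      _ ≤ _ := by
          refine measure_mono ?_
          rintro _ ⟨y, hy, rfl⟩
          have hyn := mem_ball_zero_iff.1 hy
          constructor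
          · rw [Metric.mem_ball, dist_eq_norm]
            have h2 := χ.lipschitz _ (χ.flatten_mem_ball hs.le hs1 (hsub hy)) 0
              (Metric.mem_ball_self hρ)
            rw [sub_zero, χ.map_zero] at h2
            have h3 := norm_flatten_le χ.norm_normal hs.le hs1 y
            refine lt_of_le_of_lt h2 ?_
            linarith
          · refine (χ.infDist_flat_le hs.le hs1 hρ1 hy).trans_lt ?_
            nlinarith

/-- Pull back to the fixed ball by `χ.flat s`. The outer integral contributes `s`, the factor
`|F|^(1/n)` contributes `s^(-1/n)`, and the gradient integral `s⁻¹`: squeezing does not increase the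
derivative of the chart beyond its Lipschitz bound, so only the Jacobian enters there. -/
lemma exists_lintegral_slab_le (hn : 2 ≤ n) : ∃ C : ENNReal, C ≠ ⊤ ∧
    ∀ s : ℝ, 0 < s → s ≤ 1 → ∀ u : Euc n → ℝ, ContDiff ℝ 1 u → ∃ c : ℝ,
      ∀ F ⊆ χ.slab s, MeasurableSet F → ∫⁻ x in F, ‖u x - c‖ₑ ≤
        C * ENNReal.ofReal s ^ (-(1 / (n : ℝ))) * volume F ^ (1 / (n : ℝ)) *
          ∫⁻ x in χ.slab s, ‖fderiv ℝ u x‖ₑ := by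
  obtain ⟨C, hC, hball⟩ := exists_lintegral_enorm_sub_le_ball hn χ.radius_pos
  have hθ : 0 < 1 / (n : ℝ) := by positivity
  refine ⟨8 * C * 2 ^ (1 / (n : ℝ)), ?_, fun s hs hs1 u hu => ?_⟩
  · have : (2 : ENNReal) ^ (1 / (n : ℝ)) ≠ ⊤ := ENNReal.rpow_ne_top_of_nonneg hθ.le (by simp)
    finiteness
  set B : Set (Euc n) := Metric.ball 0 χ.radius with hB
  have hflat := χ.contDiffOn_flat hs.le hs1
  obtain ⟨c, hc⟩ := hball (u ∘ χ.flat s) (hu.comp_contDiffOn hflat)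
  refine ⟨c, fun F hFs hF => ?_⟩
  set σ := ENNReal.ofReal s with hσ
  have hσ0 : σ ≠ 0 := by simpa [hσ] using hs
  have hσtop : σ ≠ ⊤ := ENNReal.ofReal_ne_top
  have h2 : (2 : ENNReal) * 2⁻¹ = 1 := ENNReal.mul_inv_cancel (by simp) (by simp)
  have hhalf : ENNReal.ofReal (s / 2) = σ * 2⁻¹ := by
    rw [ENNReal.ofReal_div_of_pos (by norm_num), div_eq_mul_inv]; simp [hσ]
  set M : Set (Euc n) := B ∩ χ.flat s ⁻¹' F with hM
  have hMm : MeasurableSet M := by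
    -- `χ.flat s` is controlled only on `B`, so measurability of the preimage goes through an
    -- extension by zero.
    obtain ⟨g, hg, hgeq⟩ : ∃ g : Euc n → Euc n, Measurable g ∧ Set.EqOn g (χ.flat s) B := by
      classical
      refine ⟨B.piecewise (χ.flat s) 0, ?_, Set.piecewise_eqOn _ _ _⟩
      exact hflat.continuousOn.measurable_piecewise continuousOn_const
        Metric.isOpen_ball.measurableSet
    have : M = B ∩ g ⁻¹' F := by
      ext y
      exact and_congr_right fun hy => by rw [Set.mem_preimage, Set.mem_preimage, hgeq hy]
    rw [this]
    exact Metric.isOpen_ball.measurableSet.inter (hg hF)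
  have hMB : M ⊆ B := Set.inter_subset_left
  have hMF : χ.flat s '' M = F := by
    apply Set.Subset.antisymm
    · rintro _ ⟨y, hy, rfl⟩
      exact hy.2
    · intro x hx
      obtain ⟨y, hy, rfl⟩ := hFs hx
      exact ⟨y, ⟨hy, hx⟩, rfl⟩
  have hvol : volume M ≤ 2 * σ⁻¹ * volume F := by
    have h1 := χ.le_lintegral_image_flat hs hs1 hMm hMB 1
    simp only [Pi.one_apply, setLIntegral_one] at h1
    rw [hMF, hhalf] at h1
    calc volume M = 2 * σ⁻¹ * (σ * 2⁻¹ * volume M) := by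
          have : 2 * σ⁻¹ * (σ * 2⁻¹ * volume M) = (2 * 2⁻¹) * (σ * σ⁻¹) * volume M := by ring
          rw [this, h2, ENNReal.mul_inv_cancel hσ0 hσtop, one_mul, one_mul]
      _ ≤ _ := by gcongr
  have hgrad : ∫⁻ y in B, ‖fderiv ℝ (u ∘ χ.flat s) y‖ₑ ≤
      2 * (2 * σ⁻¹ * ∫⁻ x in χ.slab s, ‖fderiv ℝ u x‖ₑ) := by
    have h1 := χ.le_lintegral_image_flat hs hs1 Metric.isOpen_ball.measurableSet subset_rfl
      (fun x => ‖fderiv ℝ u x‖ₑ)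
    rw [hhalf] at h1
    have h3 : ∫⁻ y in B, ‖fderiv ℝ u (χ.flat s y)‖ₑ ≤
        2 * σ⁻¹ * ∫⁻ x in χ.slab s, ‖fderiv ℝ u x‖ₑ := by
      set J := ∫⁻ y in B, ‖fderiv ℝ u (χ.flat s y)‖ₑ
      calc J = 2 * σ⁻¹ * (σ * 2⁻¹ * J) := by
            have : 2 * σ⁻¹ * (σ * 2⁻¹ * J) = (2 * 2⁻¹) * (σ * σ⁻¹) * J := by ring
            rw [this, h2, ENNReal.mul_inv_cancel hσ0 hσtop, one_mul, one_mul]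
        _ ≤ _ := mul_le_mul_right h1 _
    refine le_trans ?_ (mul_le_mul_right h3 _)
    rw [← lintegral_const_mul' _ _ (by simp)]
    refine setLIntegral_mono_ae' Metric.isOpen_ball.measurableSet (ae_of_all _ fun y hy => ?_)
    have hd := ((hu.differentiable one_ne_zero).differentiableAt.hasFDerivAt
      (x := χ.flat s y)).comp y (χ.hasFDerivAt_flat hs.le hs1 hy)
    rw [hd.fderiv]
    refine (ContinuousLinearMap.opENorm_comp_le _ _).trans ?_
    rw [mul_comm]
    gcongr
    have hlip : ‖(fderiv ℝ χ.toFun (flatten χ.normal s y)).comp (flatten χ.normal s)‖ ≤ 2 := by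
      refine (χ.hasFDerivAt_flat hs.le hs1 hy).le_of_lip' (by norm_num) ?_
      filter_upwards [Metric.isOpen_ball.mem_nhds hy] with x hx
      refine (χ.lipschitz _ (χ.flatten_mem_ball hs.le hs1 hx) _
        (χ.flatten_mem_ball hs.le hs1 hy)).trans ?_
      rw [← map_sub]
      gcongr
      exact norm_flatten_le χ.norm_normal hs.le hs1 _
    rw [← ofReal_norm]
    calc _ ≤ ENNReal.ofReal 2 := ENNReal.ofReal_le_ofReal hlip
      _ = 2 := by simp
  calc ∫⁻ x in F, ‖u x - c‖ₑ ≤ 2 * σ * ∫⁻ y in M, ‖u (χ.flat s y) - c‖ₑ := by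
        conv_lhs => rw [← hMF]
        exact χ.lintegral_image_flat_le hs hs1 hMm hMB (fun x => ‖u x - c‖ₑ)
    _ ≤ 2 * σ * (C * volume M ^ (1 / (n : ℝ)) * ∫⁻ y in B, ‖fderiv ℝ (u ∘ χ.flat s) y‖ₑ) := by
        gcongr
        exact hc M hMm hMB
    _ ≤ 2 * σ * (C * (2 * σ⁻¹ * volume F) ^ (1 / (n : ℝ)) *
          (2 * (2 * σ⁻¹ * ∫⁻ x in χ.slab s, ‖fderiv ℝ u x‖ₑ))) := by gcongr
    _ = (σ * σ⁻¹) * (8 * C * 2 ^ (1 / (n : ℝ)) * σ ^ (-(1 / (n : ℝ))) *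
          volume F ^ (1 / (n : ℝ)) * ∫⁻ x in χ.slab s, ‖fderiv ℝ u x‖ₑ) := by
        rw [ENNReal.mul_rpow_of_nonneg _ _ hθ.le, ENNReal.mul_rpow_of_nonneg _ _ hθ.le,
          ENNReal.inv_rpow, ENNReal.rpow_neg]
        ring
    _ = _ := by rw [ENNReal.mul_inv_cancel hσ0 hσtop, one_mul]

end StraighteningChart

/-! ### Gluing the local inequalities along the hypersurface -/

/-- A family of sets `q r`, `0 < r < δ`, of volume at most of order `r`, which satisfies uniformly
the weak-type Poincaré–Sobolev inequality at the scale of the tubes `tube S r`. -/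
def IsPoincareFamily {n : ℕ} (S : Set (Euc n)) (δ : ℝ) (q : ℝ → Set (Euc n)) : Prop :=
  ∃ C : ENNReal, C ≠ ⊤ ∧ ∀ r : ℝ, 0 < r → r < δ →
    MeasurableSet (q r) ∧ volume (q r) ≤ C * ENNReal.ofReal r ∧
    ∀ u : Euc n → ℝ, ContDiff ℝ 1 u → ∃ c : ℝ, ∀ F ⊆ q r, MeasurableSet F →
      ∫⁻ x in F, ‖u x - c‖ₑ ≤ C * ENNReal.ofReal r ^ (-(1 / (n : ℝ))) *
        volume F ^ (1 / (n : ℝ)) * ∫⁻ x in tube S r, ‖fderiv ℝ u x‖ₑ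

/-- On the overlap both constants approximate `u`, so `|c₂ - c₁|` times its volume is at most a
multiple of the gradient mass. The powers of `r` cancel, giving `|c₂ - c₁| = O(r⁻¹ ∫ |∇u|)`; `c₁`
then serves for the union. -/
lemma IsPoincareFamily.union {n : ℕ} (hn : 2 ≤ n) {S : Set (Euc n)} {δ : ℝ}
    {q₁ q₂ : ℝ → Set (Euc n)} (h₁ : IsPoincareFamily S δ q₁) (h₂ : IsPoincareFamily S δ q₂)
    {a : ENNReal} (ha : a ≠ 0)
    (hoverlap : ∀ r : ℝ, 0 < r → r < δ → a * ENNReal.ofReal r ≤ volume (q₁ r ∩ q₂ r)) :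
    IsPoincareFamily S δ fun r => q₁ r ∪ q₂ r := by
  obtain ⟨C₁, hC₁, h₁⟩ := h₁
  obtain ⟨C₂, hC₂, h₂⟩ := h₂
  have hn1 : (1 : ℝ) < n := by exact_mod_cast (by lia : 1 < n)
  set θ : ℝ := 1 / (n : ℝ) with hθdef
  have hθ : 0 < θ := by positivity
  have hθ1 : θ < 1 := (div_lt_one (by linarith)).2 hn1
  set D : ENNReal := (C₁ + C₂) * C₁ ^ θ with hD
  refine ⟨C₁ + C₂ + C₂ ^ (1 - θ) * a⁻¹ * D, ?_, fun r hr hrδ => ?_⟩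
  · have e1 : C₁ ^ θ ≠ ⊤ := ENNReal.rpow_ne_top_of_nonneg hθ.le hC₁
    have e2 : C₂ ^ (1 - θ) ≠ ⊤ := ENNReal.rpow_ne_top_of_nonneg (by linarith) hC₂
    have e3 : a⁻¹ ≠ ⊤ := ENNReal.inv_ne_top.2 ha
    rw [hD]
    finiteness
  obtain ⟨hm₁, hv₁, hP₁⟩ := h₁ r hr hrδ
  obtain ⟨hm₂, hv₂, hP₂⟩ := h₂ r hr hrδ
  set ρ := ENNReal.ofReal r with hρ
  have hρ0 : ρ ≠ 0 := by simpa [hρ] using hr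
  have hρtop : ρ ≠ ⊤ := ENNReal.ofReal_ne_top
  refine ⟨hm₁.union hm₂, ?_, fun u hu => ?_⟩
  · calc _ ≤ C₁ * ρ + C₂ * ρ := (measure_union_le _ _).trans (add_le_add hv₁ hv₂)
      _ = (C₁ + C₂) * ρ := by ring
      _ ≤ _ := mul_le_mul_left le_self_add _
  obtain ⟨c₁, hc₁⟩ := hP₁ u hu
  obtain ⟨c₂, hc₂⟩ := hP₂ u hu
  set G := ∫⁻ x in tube S r, ‖fderiv ℝ u x‖ₑ with hG
  have hum : Measurable u := hu.continuous.measurable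
  have hdiff : ‖c₂ - c₁‖ₑ ≤ a⁻¹ * ρ⁻¹ * (D * G) := by
    set O := q₁ r ∩ q₂ r with hO
    have hOm : MeasurableSet O := hm₁.inter hm₂
    have hOv : volume O ≤ C₁ * ρ := (measure_mono Set.inter_subset_left).trans hv₁
    have haρ : a * ρ ≠ ⊤ := ((hoverlap r hr hrδ).trans_lt
      (hOv.trans_lt (ENNReal.mul_lt_top hC₁.lt_top hρtop.lt_top))).ne
    have h3 : ‖c₂ - c₁‖ₑ * (a * ρ) ≤ D * G := by
      calc ‖c₂ - c₁‖ₑ * (a * ρ) ≤ ‖c₂ - c₁‖ₑ * volume O := by gcongr; exact hoverlap r hr hrδ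
        _ = ∫⁻ x in O, ‖c₂ - c₁‖ₑ := (setLIntegral_const _ _).symm
        _ ≤ ∫⁻ x in O, (‖u x - c₁‖ₑ + ‖u x - c₂‖ₑ) := by
            refine lintegral_mono fun x => ?_
            have : c₂ - c₁ = (u x - c₁) - (u x - c₂) := by ring
            simp only
            rw [this]
            exact enorm_sub_le
        _ = (∫⁻ x in O, ‖u x - c₁‖ₑ) + ∫⁻ x in O, ‖u x - c₂‖ₑ :=
            lintegral_add_left (hum.sub_const _).enorm _
        _ ≤ C₁ * ρ ^ (-θ) * volume O ^ θ * G + C₂ * ρ ^ (-θ) * volume O ^ θ * G :=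
            add_le_add (hc₁ O Set.inter_subset_left hOm) (hc₂ O Set.inter_subset_right hOm)
        _ = (C₁ + C₂) * ρ ^ (-θ) * volume O ^ θ * G := by ring
        _ ≤ (C₁ + C₂) * ρ ^ (-θ) * (C₁ * ρ) ^ θ * G := by gcongr
        _ = D * G * (ρ ^ (-θ) * ρ ^ θ) := by
            rw [ENNReal.mul_rpow_of_nonneg _ _ hθ.le, hD]
            ring
        _ = D * G := by
            rw [← ENNReal.rpow_add _ _ hρ0 hρtop]
            simp
    have h4 := (ENNReal.le_div_iff_mul_le (Or.inl (mul_ne_zero ha hρ0)) (Or.inl haρ)).2 h3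
    rwa [div_eq_mul_inv, ENNReal.mul_inv (Or.inl ha) (Or.inr hρ0), mul_comm] at h4
  refine ⟨c₁, fun F hF hFm => ?_⟩
  have hF₂ : F \ q₁ r ⊆ q₂ r := fun x hx => (hF hx.1).resolve_left hx.2
  have hF₂m : MeasurableSet (F \ q₁ r) := hFm.diff hm₁
  have hone : ∫⁻ x in F ∩ q₁ r, ‖u x - c₁‖ₑ ≤ C₁ * ρ ^ (-θ) * volume F ^ θ * G := by
    refine (hc₁ _ Set.inter_subset_right (hFm.inter hm₁)).trans ?_
    gcongr
    exact Set.inter_subset_left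
  -- Since `|q₂ r| = O(r)`, a factor `r^(1-θ)` can be split off; with the `r⁻¹` from `hdiff` it
  -- leaves the required `r^(-θ)`.
  have hvol : volume (F \ q₁ r) ≤ volume F ^ θ * (C₂ * ρ) ^ (1 - θ) := by
    calc volume (F \ q₁ r) = volume (F \ q₁ r) ^ θ * volume (F \ q₁ r) ^ (1 - θ) := by
          rw [← ENNReal.rpow_add_of_nonneg _ _ hθ.le (by linarith)]
          simp
      _ ≤ _ := by
          have : 0 ≤ 1 - θ := by linarith
          gcongr
          · exact Set.sdiff_subset
          · exact (measure_mono hF₂).trans hv₂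
  have htwo : ∫⁻ x in F \ q₁ r, ‖u x - c₁‖ₑ ≤ C₂ * ρ ^ (-θ) * volume F ^ θ * G +
      C₂ ^ (1 - θ) * a⁻¹ * D * ρ ^ (-θ) * volume F ^ θ * G := by
    calc ∫⁻ x in F \ q₁ r, ‖u x - c₁‖ₑ
        ≤ ∫⁻ x in F \ q₁ r, (‖u x - c₂‖ₑ + ‖c₂ - c₁‖ₑ) := by
          refine lintegral_mono fun x => ?_
          have : u x - c₁ = (u x - c₂) + (c₂ - c₁) := by ring
          simp only
          rw [this]
          exact enorm_add_le _ _
      _ = (∫⁻ x in F \ q₁ r, ‖u x - c₂‖ₑ) + ‖c₂ - c₁‖ₑ * volume (F \ q₁ r) := by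
          rw [lintegral_add_right _ measurable_const, setLIntegral_const]
      _ ≤ C₂ * ρ ^ (-θ) * volume F ^ θ * G +
          (a⁻¹ * ρ⁻¹ * (D * G)) * (volume F ^ θ * (C₂ * ρ) ^ (1 - θ)) := by
          gcongr
          refine (hc₂ _ hF₂ hF₂m).trans ?_
          gcongr
          exact Set.sdiff_subset
      _ = _ := by
          rw [ENNReal.mul_rpow_of_nonneg _ _ (by linarith : 0 ≤ 1 - θ)]
          have e : ρ ^ (-θ) = ρ⁻¹ * ρ ^ (1 - θ) := by
            rw [← ENNReal.rpow_neg_one, ← ENNReal.rpow_add _ _ hρ0 hρtop]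
            congr 1; ring
          congr 1
          rw [e]
          ring
  calc ∫⁻ x in F, ‖u x - c₁‖ₑ
      ≤ (∫⁻ x in F ∩ q₁ r, ‖u x - c₁‖ₑ) + ∫⁻ x in F \ q₁ r, ‖u x - c₁‖ₑ := by
        conv_lhs => rw [← Set.inter_union_sdiff F (q₁ r)]
        exact lintegral_union_le _ _ _
    _ ≤ _ := add_le_add hone htwo
    _ = _ := by ring

/-- The part near `K` of every sufficiently thin tube around `S` lies in a Poincaré family. -/
def IsPoincareNear {n : ℕ} (S : Set (Euc n)) (δ : ℝ) (K : Set (Euc n)) : Prop :=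
  ∃ q : ℝ → Set (Euc n), IsPoincareFamily S δ q ∧ ∃ c η : ℝ, 0 < c ∧ 0 < η ∧
    ∀ r : ℝ, 0 < r → r < δ → tube S (c * r) ∩ Metric.thickening η K ⊆ q r

lemma IsPoincareNear.mono {n : ℕ} {S K K' : Set (Euc n)} {δ : ℝ} (h : IsPoincareNear S δ K)
    (hK : K' ⊆ K) : IsPoincareNear S δ K' := by
  obtain ⟨q, hq, c, η, hc, hη, hsub⟩ := h
  exact ⟨q, hq, c, η, hc, hη, fun r hr hrδ =>
    (Set.inter_subset_inter_right _ (Metric.thickening_subset_of_subset _ hK)).trans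
      (hsub r hr hrδ)⟩

/-- A common point `p` supplies the overlap: both families contain the part near `p` of a thin tube,
whose volume is at least of order `r`. The bound `c ≤ 1 / δ` gives `c r ≤ 1`, the range of that
volume estimate. -/
lemma IsPoincareNear.union {n : ℕ} (hn : 2 ≤ n) {S K₁ K₂ : Set (Euc n)} {δ : ℝ} (hδ : 0 < δ)
    (h₁ : IsPoincareNear S δ K₁) (h₂ : IsPoincareNear S δ K₂) {p : Euc n}
    (χ : StraighteningChart S p) (hp₁ : p ∈ K₁) (hp₂ : p ∈ K₂) :
    IsPoincareNear S δ (K₁ ∪ K₂) := by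
  obtain ⟨q₁, hq₁, c₁, η₁, hc₁, hη₁, hsub₁⟩ := h₁
  obtain ⟨q₂, hq₂, c₂, η₂, hc₂, hη₂, hsub₂⟩ := h₂
  set c := min (min c₁ c₂) (1 / δ) with hc
  have hcpos : 0 < c := by positivity
  have hcc₁ : c ≤ c₁ := (min_le_left _ _).trans (min_le_left _ _)
  have hcc₂ : c ≤ c₂ := (min_le_left _ _).trans (min_le_right _ _)
  have hcδ : c ≤ 1 / δ := min_le_right _ _
  set η := min η₁ η₂ with hη
  have hηpos : 0 < η := by positivity
  have hsub₁' : ∀ r, 0 < r → r < δ → tube S (c * r) ∩ Metric.thickening η K₁ ⊆ q₁ r :=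
    fun r hr hrδ => (Set.inter_subset_inter (tube_mono S (by gcongr))
      (Metric.thickening_mono (min_le_left _ _) _)).trans (hsub₁ r hr hrδ)
  have hsub₂' : ∀ r, 0 < r → r < δ → tube S (c * r) ∩ Metric.thickening η K₂ ⊆ q₂ r :=
    fun r hr hrδ => (Set.inter_subset_inter (tube_mono S (by gcongr))
      (Metric.thickening_mono (min_le_right _ _) _)).trans (hsub₂ r hr hrδ)
  obtain ⟨v, hv0, hv⟩ := χ.exists_le_volume_ball_inter_tube hηpos
  refine ⟨fun r => q₁ r ∪ q₂ r, hq₁.union hn hq₂ (a := v * ENNReal.ofReal c) ?_ ?_,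
    c, η, hcpos, hηpos, fun r hr hrδ => ?_⟩
  · exact mul_ne_zero hv0 (by simpa using hcpos)
  · intro r hr hrδ
    have hcr : c * r ≤ 1 := by
      calc c * r ≤ 1 / δ * δ := by gcongr
        _ = 1 := by field_simp
    rw [mul_assoc, ← ENNReal.ofReal_mul hcpos.le]
    refine (hv (c * r) (by positivity) hcr).trans (measure_mono ?_)
    rintro x ⟨hx1, hx2⟩
    exact ⟨hsub₁' r hr hrδ ⟨hx2, Metric.mem_thickening_iff.2 ⟨p, hp₁, hx1⟩⟩,
      hsub₂' r hr hrδ ⟨hx2, Metric.mem_thickening_iff.2 ⟨p, hp₂, hx1⟩⟩⟩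
  · rw [Metric.thickening_union, Set.inter_union_distrib_left]
    exact Set.union_subset_union (hsub₁' r hr hrδ) (hsub₂' r hr hrδ)

lemma StraighteningChart.exists_isPoincareNear_ball {n : ℕ} (hn : 2 ≤ n) {S : Set (Euc n)}
    {z : Euc n} (χ : StraighteningChart S z) (hz : z ∈ S) {δ : ℝ} (hδ : 0 < δ) :
    ∃ η : ℝ, 0 < η ∧ IsPoincareNear S δ (Metric.ball z η) := by
  have hρ := χ.radius_pos
  have hθ : 0 < 1 / (n : ℝ) := by positivity
  obtain ⟨c, η, hc, hη, hball⟩ := χ.exists_ball_inter_tube_subset_slab hz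
  obtain ⟨C, hC, hP⟩ := χ.exists_lintegral_slab_le hn
  -- `1 / δ` makes `k r ≤ 1`, and `1 / (2 * χ.radius)` places the slab of parameter `k r` inside
  -- `tube S r`.
  set k := min (1 / δ) (1 / (2 * χ.radius)) with hk
  have hkpos : 0 < k := by positivity
  have hkr : ∀ r, 0 < r → r < δ → k * r ≤ 1 := fun r hr hrδ => by
    calc k * r ≤ 1 / δ * δ := by gcongr; exact min_le_left _ _
      _ = 1 := by field_simp
  have hkρ : 2 * χ.radius * k ≤ 1 := by
    calc 2 * χ.radius * k ≤ 2 * χ.radius * (1 / (2 * χ.radius)) := by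
          gcongr; exact min_le_right _ _
      _ = 1 := by field_simp
  have hκ0 : ENNReal.ofReal k ≠ 0 := by simpa using hkpos
  set κ := ENNReal.ofReal k with hκ
  set v := volume (Metric.ball (0 : Euc n) χ.radius) with hv
  have hvtop : v ≠ ⊤ := measure_ball_lt_top.ne
  refine ⟨η / 2, by positivity, fun r => χ.slab (k * r),
    ⟨2 * v * κ + C * κ ^ (-(1 / (n : ℝ))), ?_, fun r hr hrδ => ⟨?_, ?_, fun u hu => ?_⟩⟩,
    c * k, η / 2, by positivity, by positivity, fun r hr hrδ => ?_⟩
  · have : κ ^ (-(1 / (n : ℝ))) ≠ ⊤ := by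
      rw [ENNReal.rpow_neg]
      refine ENNReal.inv_ne_top.2 ?_
      simp [hκ, ENNReal.rpow_eq_zero_iff, hkpos]
    finiteness
  · exact χ.measurableSet_slab (by positivity) (hkr r hr hrδ)
  · refine (χ.volume_slab_le (by positivity) (hkr r hr hrδ)).trans ?_
    rw [ENNReal.ofReal_mul hkpos.le, ← mul_assoc]
    gcongr
    exact le_self_add
  · obtain ⟨a, ha⟩ := hP (k * r) (by positivity) (hkr r hr hrδ) u hu
    refine ⟨a, fun F hF hFm => (ha F hF hFm).trans ?_⟩
    have h1 : ENNReal.ofReal (k * r) ^ (-(1 / (n : ℝ))) =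
        κ ^ (-(1 / (n : ℝ))) * ENNReal.ofReal r ^ (-(1 / (n : ℝ))) := by
      rw [ENNReal.ofReal_mul hkpos.le, ENNReal.mul_rpow_of_ne_top ENNReal.ofReal_ne_top
        ENNReal.ofReal_ne_top]
    rw [h1, ← mul_assoc C]
    gcongr
    · exact le_add_self
    · refine (χ.slab_subset_tube (by positivity) (hkr r hr hrδ)).trans (tube_mono S ?_)
      rw [← mul_assoc]
      nlinarith
  · rintro x ⟨hx1, hx2⟩
    refine hball (k * r) (by positivity) (hkr r hr hrδ) ⟨?_, by rwa [← mul_assoc]⟩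
    obtain ⟨y, hy, hxy⟩ := Metric.mem_thickening_iff.1 hx2
    rw [Metric.mem_ball] at hy ⊢
    linarith [dist_triangle x y z]

/-- Being jointly near a Poincaré family is a symmetric, transitive relation between points of `S`
that holds locally, so connectedness extends it to all pairs. Compactness then needs only finitely
many gluings. -/
lemma isPoincareNear_of_isConnected {n : ℕ} (hn : 2 ≤ n) {S : Set (Euc n)} (hconn : IsConnected S)
    (hcomp : IsCompact S) (hchart : ∀ z ∈ S, Nonempty (StraighteningChart S z)) {δ : ℝ}
    (hδ : 0 < δ) : IsPoincareNear S δ S := by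
  have hlocal : ∀ z ∈ S, ∃ η : ℝ, 0 < η ∧ IsPoincareNear S δ (Metric.ball z η) := fun z hz =>
    (hchart z hz).some.exists_isPoincareNear_ball hn hz hδ
  obtain ⟨p, hp⟩ := hconn.nonempty
  have hpair : ∀ x ∈ S, IsPoincareNear S δ {p, x} := fun x hx => by
    refine hconn.isPreconnected.induction₂ (fun x y => IsPoincareNear S δ {x, y}) ?_ ?_ ?_ hp hx
    · intro x hx
      obtain ⟨η, hη, h⟩ := hlocal x hx
      filter_upwards [mem_nhdsWithin_of_mem_nhds (Metric.ball_mem_nhds x hη)] with y hy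
      exact h.mono (Set.insert_subset (Metric.mem_ball_self hη) (Set.singleton_subset_iff.2 hy))
    · intro x y z _ hy _ hxy hyz
      refine (hxy.union hn hδ hyz (hchart y hy).some (by simp) (by simp)).mono ?_
      rintro w (rfl | rfl) <;> simp
    · intro x y _ _ h
      rwa [Set.pair_comm]
  obtain ⟨ηp, hηp, hp_ball⟩ := hlocal p hp
  refine IsPoincareNear.mono (K := S ∪ {p}) ?_ Set.subset_union_left
  -- Carrying the base point `p` along guarantees that any two pieces share a point at which they
  -- can be glued.
  refine hcomp.induction_on (p := fun K => IsPoincareNear S δ (K ∪ {p})) ?_ ?_ ?_ ?_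
  · exact hp_ball.mono (by simpa using hηp)
  · intro s t hst ht
    exact ht.mono (Set.union_subset_union_left _ hst)
  · intro s t hs ht
    refine (hs.union hn hδ ht (hchart p hp).some (by simp) (by simp)).mono ?_
    rintro w ((h | h) | h) <;> simp_all
  · intro x hx
    obtain ⟨η, hη, h⟩ := hlocal x hx
    refine ⟨Metric.ball x η, mem_nhdsWithin_of_mem_nhds (Metric.ball_mem_nhds x hη), ?_⟩
    refine (h.union hn hδ (hpair x hx) (hchart x hx).some (Metric.mem_ball_self hη)
      (by simp)).mono ?_
    rintro w (h | h)
    · exact Or.inl h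
    · exact Or.inr (by simp_all)

/-- The weak-type Poincaré–Sobolev inequality on tubes around a connected compact hypersurface. -/
theorem exists_lintegral_tube_sub_const_le {n : ℕ} (hn : 2 ≤ n) {S : Set (Euc n)}
    (hconn : IsConnected S) (hcomp : IsCompact S)
    (hchart : ∀ z ∈ S, Nonempty (StraighteningChart S z)) {δ : ℝ} (hδ : 0 < δ) :
    ∃ C : ENNReal, C ≠ ⊤ ∧ ∀ r : ℝ, 0 < r → r < δ → ∀ u : Euc n → ℝ, ContDiff ℝ 1 u →
      ∃ c : ℝ, ∀ F ⊆ tube S r, MeasurableSet F → ∫⁻ x in F, ‖u x - c‖ₑ ≤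
        C * ENNReal.ofReal r ^ (-(1 / (n : ℝ))) * (∫⁻ x in tube S r, ‖fderiv ℝ u x‖ₑ) *
          volume F ^ (1 / (n : ℝ)) := by
  obtain ⟨q, ⟨C, hC, hq⟩, c, η, hc, hη, hsub⟩ :=
    isPoincareNear_of_isConnected hn hconn hcomp hchart hδ
  -- With `b ≤ η / δ`, the tube of radius `b r` lies in the `η`-thickening of `S`.
  set b := min (min c 1) (η / δ) with hb
  have hbpos : 0 < b := by positivity
  have hbc : b ≤ c := (min_le_left _ _).trans (min_le_left _ _)
  have hb1 : b ≤ 1 := (min_le_left _ _).trans (min_le_right _ _)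
  obtain ⟨D, hD, htube⟩ := exists_lintegral_tube_le hn hconn.nonempty hcomp.isBounded hbpos hb1
  set Δ := ENNReal.ofReal δ with hΔ
  have hθ : 0 < 1 / (n : ℝ) := by positivity
  refine ⟨D * (C + Δ ^ (1 / (n : ℝ))), ?_, fun r hr hrδ u hu => ?_⟩
  · have : Δ ^ (1 / (n : ℝ)) ≠ ⊤ := ENNReal.rpow_ne_top_of_nonneg hθ.le ENNReal.ofReal_ne_top
    finiteness
  obtain ⟨-, -, hP⟩ := hq r hr hrδ
  obtain ⟨k, hk⟩ := hP u hu
  refine ⟨k, fun F hF hFm => ?_⟩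
  set ρ := ENNReal.ofReal r with hρ
  set G := ∫⁻ x in tube S r, ‖fderiv ℝ u x‖ₑ with hG
  have hbr : tube S (b * r) ⊆ q r := fun x hx => by
    refine hsub r hr hrδ ⟨tube_mono S (by gcongr) hx, ?_⟩
    have hbη : b * r ≤ η := by
      calc b * r ≤ η / δ * δ := by gcongr; exact min_le_right _ _
        _ = η := by field_simp
    obtain ⟨y, hy, hxy⟩ := (mem_tube_iff hconn.nonempty).1 hx
    exact Metric.mem_thickening_iff.2 ⟨y, hy, hxy.trans_le hbη⟩
  have h1 := htube r hr u hu k (C * ρ ^ (-(1 / (n : ℝ))) * G) (fun F' hF' hF'm => by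
    refine (hk F' (hF'.trans hbr) hF'm).trans (le_of_eq ?_)
    ring) F hF hFm
  refine h1.trans ?_
  -- As `r < δ`, `1 ≤ (δ / r)^(1/n)`; this absorbs the gradient term that enters without a power of
  -- `r`.
  have hone : 1 ≤ Δ ^ (1 / (n : ℝ)) * ρ ^ (-(1 / (n : ℝ))) := by
    have hρ0 : ρ ≠ 0 := by simpa [hρ] using hr
    calc (1 : ENNReal) = ρ ^ (1 / (n : ℝ)) * ρ ^ (-(1 / (n : ℝ))) := by
          rw [← ENNReal.rpow_add _ _ hρ0 ENNReal.ofReal_ne_top]; simp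
      _ ≤ _ := by gcongr; exact ENNReal.ofReal_le_ofReal hrδ.le
  refine mul_le_mul_left ?_ _
  calc D * (C * ρ ^ (-(1 / (n : ℝ))) * G + G) =
        D * (C * ρ ^ (-(1 / (n : ℝ))) + 1) * G := by ring
    _ ≤ D * (C * ρ ^ (-(1 / (n : ℝ))) + Δ ^ (1 / (n : ℝ)) * ρ ^ (-(1 / (n : ℝ)))) * G := by
        gcongr
    _ = _ := by ring

/-! ### Mollification and total variation -/

lemma divergence_comp_add {n : ℕ} (ψ : Euc n → Euc n) (t x : Euc n) :
    divergence (fun y => ψ (y + t)) x = divergence ψ (x + t) := by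
  simp only [divergence, fderiv_comp_add_right]

lemma continuous_divergence {n : ℕ} {ψ : Euc n → Euc n} (hψ : ContDiff ℝ 1 ψ) :
    Continuous (divergence ψ) := by
  have h1 : Continuous (fderiv ℝ ψ) := hψ.continuous_fderiv one_ne_zero
  refine continuous_finsetSum _ fun i _ => ?_
  exact (EuclideanSpace.proj i : Euc n →L[ℝ] ℝ).continuous.comp (h1.clm_apply continuous_const)

lemma hasCompactSupport_divergence {n : ℕ} {ψ : Euc n → Euc n} (hψ : HasCompactSupport ψ) :
    HasCompactSupport (divergence ψ) := by
  refine (hψ.fderiv ℝ).mono fun x hx => ?_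
  contrapose! hx
  simp only [Function.mem_support, not_not] at hx ⊢
  simp [divergence, hx]

lemma IsTestField.comp_add {n : ℕ} {W W' : Set (Euc n)} {ψ : Euc n → Euc n}
    (hψ : IsTestField W' ψ) {t : Euc n} (ht : ∀ y ∈ tsupport ψ, y - t ∈ W) :
    IsTestField W fun y => ψ (y + t) := by
  obtain ⟨h1, h2, h3, h4⟩ := hψ
  refine ⟨h1.comp (contDiff_id.add contDiff_const), h2.comp_homeomorph (Homeomorph.addRight t), ?_,
    fun x => h4 _⟩
  intro y hy
  have : y + t ∈ tsupport ψ := by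
    have h := tsupport_comp_eq_preimage ψ (Homeomorph.addRight t)
    have hy' : y ∈ tsupport (ψ ∘ (Homeomorph.addRight t)) := hy
    rw [h] at hy'
    exact hy'
  simpa using ht _ this

lemma integral_mul_divergence_le {n : ℕ} {u : Euc n → ℝ} {W : Set (Euc n)}
    (hTV : totalVariation u W ≠ ⊤) {ψ : Euc n → Euc n} (hψ : IsTestField W ψ) :
    ∫ x, u x * divergence ψ x ≤ (totalVariation u W).toReal := by
  have h1 : ENNReal.ofReal (∫ x, u x * divergence ψ x) ≤ totalVariation u W :=
    le_iSup₂ (f := fun (φ : Euc n → Euc n) (_ : IsTestField W φ) =>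
      ENNReal.ofReal (∫ x, u x * divergence φ x)) ψ hψ
  exact (ENNReal.ofReal_le_iff_le_toReal hTV).1 h1

open scoped Convolution in
/-- The mollification of `u` with the kernel `φ`. -/
noncomputable def mollify {n : ℕ} (φ : ContDiffBump (0 : Euc n)) (u : Euc n → ℝ) : Euc n → ℝ :=
  φ.normed volume ⋆[ContinuousLinearMap.lsmul ℝ ℝ, volume] u

lemma contDiff_mollify {n : ℕ} (φ : ContDiffBump (0 : Euc n)) {u : Euc n → ℝ}
    (hu : LocallyIntegrable u) : ContDiff ℝ 2 (mollify φ u) :=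
  φ.hasCompactSupport_normed.contDiff_convolution_left (n := 2) _ φ.contDiff_normed hu

/-- Fubini moves the mollifier from `u` to the test field, giving a weighted average of the pairings
of `u` with translates of `ψ`; each translate is admissible on `W`. -/
lemma integral_mollify_mul_divergence_le {n : ℕ} {u : Euc n → ℝ} (hu : Measurable u)
    (hu1 : ∀ x, ‖u x‖ ≤ 1) {W W' : Set (Euc n)} (hTV : totalVariation u W ≠ ⊤)
    (φ : ContDiffBump (0 : Euc n)) {ψ : Euc n → Euc n} (hψ : IsTestField W' ψ)
    (hW : ∀ y ∈ tsupport ψ, ∀ t : Euc n, ‖t‖ ≤ φ.rOut → y - t ∈ W) :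
    ∫ x, mollify φ u x * divergence ψ x ≤ (totalVariation u W).toReal := by
  set k : Euc n → ℝ := φ.normed volume with hk
  set h := divergence ψ with hh
  have hkint : Integrable k := φ.integrable_normed
  have hhint : Integrable h := (continuous_divergence hψ.1).integrable_of_hasCompactSupport
    (hasCompactSupport_divergence hψ.2.1)
  have hprod : Integrable (Function.uncurry fun (x t : Euc n) => k t * u (x - t) * h x)
      (volume.prod volume) := by
    have h1 : Integrable (fun p : Euc n × Euc n => h p.1 * k p.2) (volume.prod volume) :=
      hhint.mul_prod hkint
    have h2 : AEStronglyMeasurable (fun p : Euc n × Euc n => u (p.1 - p.2))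
        (volume.prod volume) := (hu.comp (by fun_prop)).aestronglyMeasurable
    have h3 := h1.bdd_mul h2 (c := 1) (ae_of_all _ fun p => hu1 _)
    convert! h3 using 1
    ext ⟨x, t⟩
    simp only [Function.uncurry]
    ring
  calc ∫ x, mollify φ u x * h x = ∫ x, ∫ t, k t * u (x - t) * h x := by
        refine integral_congr_ae (ae_of_all _ fun x => ?_)
        simp only [mollify, convolution, ContinuousLinearMap.lsmul_apply, smul_eq_mul]
        rw [integral_mul_const]
    _ = ∫ t, ∫ x, k t * u (x - t) * h x := integral_integral_swap hprod
    _ = ∫ t, k t * ∫ x, u x * divergence (fun y => ψ (y + t)) x := by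
        refine integral_congr_ae (ae_of_all _ fun t => ?_)
        simp only
        rw [← integral_const_mul, ← integral_add_right_eq_self _ t]
        refine integral_congr_ae (ae_of_all _ fun x => ?_)
        simp only [divergence_comp_add, add_sub_cancel_right, hh]
        ring
    _ ≤ ∫ t, k t * (totalVariation u W).toReal := by
        set J : Euc n → ℝ := fun t => k t * ∫ x, u x * divergence (fun y => ψ (y + t)) x with hJ
        have hk0 : ∀ t, 0 ≤ k t := fun t => φ.nonneg_normed t
        have hJle : ∀ t, J t ≤ k t * (totalVariation u W).toReal := fun t => by
          rcases eq_or_ne (k t) 0 with h0 | h0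
          · simp [hJ, h0]
          have ht : ‖t‖ ≤ φ.rOut := by
            have : t ∈ Function.support (φ.normed volume) := h0
            rw [φ.support_normed_eq] at this
            exact (mem_ball_zero_iff.1 this).le
          exact mul_le_mul_of_nonneg_left
            (integral_mul_divergence_le hTV (hψ.comp_add fun y hy => hW y hy t ht)) (hk0 t)
        by_cases hJint : Integrable J
        · exact integral_mono hJint (hkint.mul_const _) hJle
        -- If `J` is not integrable its integral is `0` by convention, and the right-hand side is
        -- nonnegative.
        · rw [integral_undef hJint]
          exact integral_nonneg fun t => mul_nonneg (hk0 t) ENNReal.toReal_nonneg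
    _ = (totalVariation u W).toReal := by
        rw [integral_mul_const, hk, φ.integral_normed, one_mul]

lemma integral_mul_divergence_eq {n : ℕ} {w : Euc n → ℝ} (hw : ContDiff ℝ 1 w)
    {ψ : Euc n → Euc n} (hψ : ContDiff ℝ 1 ψ) (hψc : HasCompactSupport ψ) :
    ∫ x, w x * divergence ψ x = -∫ x, fderiv ℝ w x (ψ x) := by
  have hψi : ∀ i : Fin n, ContDiff ℝ 1 fun x => ψ x i := fun i =>
    (EuclideanSpace.proj i : Euc n →L[ℝ] ℝ).contDiff.comp hψ
  have hψic : ∀ i : Fin n, HasCompactSupport fun x => ψ x i := fun i =>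
    hψc.comp_left (g := fun y : Euc n => y i) rfl
  have hder : ∀ (i : Fin n) (x v : Euc n), fderiv ℝ (fun x => ψ x i) x v = (fderiv ℝ ψ x v) i := by
    intro i x v
    have := ((EuclideanSpace.proj i : Euc n →L[ℝ] ℝ).hasFDerivAt.comp x
      (hψ.differentiable one_ne_zero x).hasFDerivAt).fderiv
    have h2 : (fun x => ψ x i) = (EuclideanSpace.proj i : Euc n →L[ℝ] ℝ) ∘ ψ := rfl
    rw [h2, this]
    rfl
  have hdc : ∀ (i : Fin n), Continuous fun x => fderiv ℝ (fun x => ψ x i) x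
      (EuclideanSpace.single i 1) := fun i =>
    ((hψi i).continuous_fderiv one_ne_zero).clm_apply continuous_const
  have hdcs : ∀ (i : Fin n), HasCompactSupport fun x => fderiv ℝ (fun x => ψ x i) x
      (EuclideanSpace.single i 1) := fun i => (hψic i).fderiv_apply ℝ _
  have hwd : ∀ i : Fin n, Continuous fun x => fderiv ℝ w x (EuclideanSpace.single i 1) := fun i =>
    (hw.continuous_fderiv one_ne_zero).clm_apply continuous_const
  have hi1 : ∀ i : Fin n, Integrable fun x => w x * fderiv ℝ (fun x => ψ x i) x
      (EuclideanSpace.single i 1) := fun i =>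
    (hw.continuous.mul (hdc i)).integrable_of_hasCompactSupport (hdcs i).mul_left
  have hi2 : ∀ i : Fin n, Integrable fun x => fderiv ℝ w x (EuclideanSpace.single i 1) * ψ x i :=
    fun i => ((hwd i).mul (hψi i).continuous).integrable_of_hasCompactSupport (hψic i).mul_left
  have hparts : ∀ i : Fin n, ∫ x, w x * fderiv ℝ (fun x => ψ x i) x (EuclideanSpace.single i 1) =
      -∫ x, fderiv ℝ w x (EuclideanSpace.single i 1) * ψ x i := fun i =>
    integral_mul_fderiv_eq_neg_fderiv_mul_of_integrable (hi2 i) (hi1 i)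
      ((hw.continuous.mul (hψi i).continuous).integrable_of_hasCompactSupport (hψic i).mul_left)
      (fun x _ => hw.differentiable one_ne_zero x)
      (fun x _ => (hψi i).differentiable one_ne_zero x)
  have e1 : ∀ x, w x * divergence ψ x = ∑ i : Fin n, w x * fderiv ℝ (fun x => ψ x i) x
      (EuclideanSpace.single i 1) := fun x => by
    simp only [divergence, hder, Finset.mul_sum]
  have e2 : ∀ x, fderiv ℝ w x (ψ x) =
      ∑ i : Fin n, fderiv ℝ w x (EuclideanSpace.single i 1) * ψ x i := fun x => by
    conv_lhs => rw [← (EuclideanSpace.basisFun (Fin n) ℝ).sum_repr (ψ x)]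
    simp [map_sum, mul_comm]
  simp_rw [e1, e2]
  rw [integral_finsetSum _ fun i _ => hi1 i, integral_finsetSum _ fun i _ => hi2 i,
    ← Finset.sum_neg_distrib]
  exact Finset.sum_congr rfl fun i _ => hparts i

open scoped Manifold ContDiff in
lemma exists_cutoff {n : ℕ} {K : Set (Euc n)} (hK : IsCompact K) {ε : ℝ} (hε : 0 < ε) :
    ∃ χ : Euc n → ℝ, ContDiff ℝ 1 χ ∧ HasCompactSupport χ ∧ tsupport χ ⊆ Metric.cthickening ε K ∧
      (∀ x, 0 ≤ χ x) ∧ (∀ x, χ x ≤ 1) ∧ ∀ x ∈ K, χ x = 1 := by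
  obtain ⟨χ, h1, h2, h3, h4⟩ := exists_contMDiff_support_eq_eq_one_iff (n := 1) 𝓘(ℝ, Euc n)
    (Metric.isOpen_thickening (δ := ε) (E := K)) hK.isClosed (Metric.self_subset_thickening hε K)
  have hts : tsupport χ ⊆ Metric.cthickening ε K := by
    rw [tsupport, h3]
    exact Metric.closure_thickening_subset_cthickening _ _
  refine ⟨χ, by simpa using contMDiff_iff_contDiff.1 h1, ?_, hts, ?_, ?_, fun x hx => (h4 x).1 hx⟩
  · exact HasCompactSupport.of_support_subset_isCompact (hK.cthickening (r := ε))
      ((subset_tsupport χ).trans hts)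
  · exact fun x => (h2 (Set.mem_range_self x)).1
  · exact fun x => (h2 (Set.mem_range_self x)).2

/-- Test against a cut-off, regularized version of `-∇w / |∇w|`, with `w` the mollification. Half of
the distance from `K` to the complement of `W` is spent on the cutoff, half on the mollification
radius. -/
lemma lintegral_enorm_fderiv_mollify_le {n : ℕ} {u : Euc n → ℝ} (hu : Measurable u)
    (hu1 : ∀ x, ‖u x‖ ≤ 1) (hul : LocallyIntegrable u) {W K : Set (Euc n)} (hW : IsOpen W)
    (hK : IsCompact K) (hKW : K ⊆ W) (hTV : totalVariation u W ≠ ⊤) :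
    ∃ ε : ℝ, 0 < ε ∧ ∀ φ : ContDiffBump (0 : Euc n), φ.rOut ≤ ε →
      ∫⁻ x in K, ‖fderiv ℝ (mollify φ u) x‖ₑ ≤ totalVariation u W := by
  obtain ⟨d, hd, hdW⟩ := hK.exists_cthickening_subset_open hW hKW
  refine ⟨d / 2, by positivity, fun φ hφ => ?_⟩
  obtain ⟨χ, hχ, hχc, hχs, hχ0, hχ1, hχK⟩ := exists_cutoff hK (half_pos hd)
  set w := mollify φ u with hw
  have hw2 : ContDiff ℝ 2 w := contDiff_mollify φ hul
  have hw1 : ContDiff ℝ 1 w := hw2.of_le (by norm_num)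
  set g : Euc n → Euc n := gradient w with hg
  have hg1 : ContDiff ℝ 1 g :=
    (InnerProductSpace.toDual ℝ (Euc n)).symm.contDiff.comp
      (hw2.fderiv_right (m := 1) (by norm_num))
  have hgn : ∀ x, ‖g x‖ = ‖fderiv ℝ w x‖ := fun x => LinearIsometryEquiv.norm_map _ _
  have hgi : ∀ x v, fderiv ℝ w x v = inner ℝ (g x) v := fun x v => by
    simp [hg, gradient]
  set P := (totalVariation u W).toReal with hP
  have hχint : Integrable χ := hχ.continuous.integrable_of_hasCompactSupport hχc
  have hχg : Continuous fun x => χ x * ‖g x‖ := hχ.continuous.mul hg1.continuous.norm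
  have hχgint : Integrable fun x => χ x * ‖g x‖ :=
    hχg.integrable_of_hasCompactSupport hχc.mul_right
  have key : ∀ η : ℝ, 0 < η → (∫ x, χ x * ‖g x‖) - η * (∫ x, χ x) ≤ P := by
    intro η hη
    set N : Euc n → ℝ := fun x => Real.sqrt (‖g x‖ ^ 2 + η ^ 2) with hN
    have hNpos : ∀ x, 0 < N x := fun x => Real.sqrt_pos.2 (by positivity)
    have hNsq : ∀ x, N x ^ 2 = ‖g x‖ ^ 2 + η ^ 2 := fun x => Real.sq_sqrt (by positivity)
    have hN1 : ContDiff ℝ 1 N :=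
      ((hg1.norm_sq ℝ).add contDiff_const).sqrt fun x => by positivity
    have hgN : ∀ x, ‖g x‖ ≤ N x := fun x => Real.le_sqrt_of_sq_le (by nlinarith)
    have hNg : ∀ x, N x ≤ ‖g x‖ + η := fun x => by
      refine Real.sqrt_le_iff.2 ⟨by positivity, ?_⟩
      nlinarith [norm_nonneg (g x)]
    -- Dividing by `√(|∇w|² + η²)` keeps the field `C¹` at critical points of `w`; the loss is at
    -- most `η χ`, since `|g| - η ≤ |g|² / N`, and `η` tends to `0` below.
    set ψ : Euc n → Euc n := fun x => -((χ x * (N x)⁻¹) • g x) with hψ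
    have hψ1 : ContDiff ℝ 1 ψ :=
      ((hχ.mul (hN1.inv fun x => (hNpos x).ne')).smul hg1).neg
    have hψs : Function.support ψ ⊆ Function.support χ := fun x hx => by
      contrapose! hx
      simp only [Function.mem_support, not_not] at hx ⊢
      simp [hψ, hx]
    have hψc : HasCompactSupport ψ := hχc.mono hψs
    have hψt : tsupport ψ ⊆ Metric.cthickening (d / 2) K := (closure_mono hψs).trans hχs
    have hψn : ∀ x, ‖ψ x‖ ≤ 1 := fun x => by
      simp only [hψ]
      rw [norm_neg, norm_smul, Real.norm_of_nonneg
        (mul_nonneg (hχ0 x) (inv_nonneg.2 (hNpos x).le)), mul_assoc]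
      have h1 : (N x)⁻¹ * ‖g x‖ ≤ 1 := by
        rw [inv_mul_le_iff₀ (hNpos x), mul_one]
        exact hgN x
      exact mul_le_one₀ (hχ1 x) (mul_nonneg (inv_nonneg.2 (hNpos x).le) (norm_nonneg _)) h1
    have htest : IsTestField (Metric.cthickening (d / 2) K) ψ := ⟨hψ1, hψc, hψt, hψn⟩
    have hle := integral_mollify_mul_divergence_le hu hu1 hTV φ htest (fun y hy t ht => by
      refine hdW ?_
      have h1 : y - t ∈ Metric.cthickening (d / 2) (Metric.cthickening (d / 2) K) := by
        refine Metric.mem_cthickening_of_dist_le _ y _ _ (hψt hy) ?_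
        rw [dist_eq_norm, sub_sub_cancel_left, norm_neg]
        exact ht.trans hφ
      have h2 := Metric.cthickening_cthickening_subset (half_pos hd).le (half_pos hd).le K h1
      rwa [add_halves] at h2)
    rw [integral_mul_divergence_eq hw1 hψ1 hψc, ← integral_neg] at hle
    refine le_trans ?_ hle
    rw [← integral_const_mul, ← integral_sub hχgint (hχint.const_mul η)]
    refine integral_mono (hχgint.sub (hχint.const_mul η)) ?_ fun x => ?_
    · have hc : Continuous fun x => fderiv ℝ w x (ψ x) :=
        (hw1.continuous_fderiv one_ne_zero).clm_apply hψ1.continuous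
      refine (hc.integrable_of_hasCompactSupport (hψc.mono fun x hx => ?_)).neg
      contrapose! hx
      simp only [Function.mem_support, not_not] at hx ⊢
      simp [hx]
    · have h1 : -(fderiv ℝ w x (ψ x)) = χ x * ((N x)⁻¹ * ‖g x‖ ^ 2) := by
        rw [hgi]
        simp only [hψ]
        rw [inner_neg_right, inner_smul_right, real_inner_self_eq_norm_sq]
        ring
      simp only
      rw [h1]
      have h2 : ‖g x‖ - η ≤ (N x)⁻¹ * ‖g x‖ ^ 2 := by
        rw [le_inv_mul_iff₀ (hNpos x)]
        rcases le_total ‖g x‖ η with h | h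
        · nlinarith [hNpos x, sq_nonneg ‖g x‖]
        · nlinarith [hNg x, hNpos x]
      calc χ x * ‖g x‖ - η * χ x = χ x * (‖g x‖ - η) := by ring
        _ ≤ _ := mul_le_mul_of_nonneg_left h2 (hχ0 x)
  have hlim : ∫ x, χ x * ‖g x‖ ≤ P := by
    refine le_of_forall_pos_le_add fun e he => ?_
    have hI : 0 ≤ ∫ x, χ x := integral_nonneg hχ0
    have h1 := key (e / ((∫ x, χ x) + 1)) (by positivity)
    have h2 : e / ((∫ x, χ x) + 1) * (∫ x, χ x) ≤ e := by
      rw [div_mul_eq_mul_div, div_le_iff₀ (by positivity)]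
      nlinarith
    linarith
  calc ∫⁻ x in K, ‖fderiv ℝ w x‖ₑ ≤ ∫⁻ x in K, ENNReal.ofReal (χ x * ‖g x‖) := by
        refine setLIntegral_mono_ae' hK.measurableSet (ae_of_all _ fun x hx => ?_)
        rw [hχK x hx, one_mul, hgn, ofReal_norm]
    _ ≤ ∫⁻ x, ENNReal.ofReal (χ x * ‖g x‖) := setLIntegral_le_lintegral _ _
    _ = ENNReal.ofReal (∫ x, χ x * ‖g x‖) :=
        (ofReal_integral_eq_lintegral_ofReal hχgint
          (ae_of_all _ fun x => mul_nonneg (hχ0 x) (norm_nonneg _))).symm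
    _ ≤ ENNReal.ofReal P := ENNReal.ofReal_le_ofReal hlim
    _ = totalVariation u W := ENNReal.ofReal_toReal hTV

/-! ### Sets of finite perimeter and the conclusion -/

-- Fatou's lemma along a subsequence. A bound for infinitely many `k` suffices, so the constants `c
-- k` of the mollified functions need not converge.
open Filter Topology in
lemma ofReal_mul_measure_le_of_frequently {α : Type*} [MeasurableSpace α] {μ : Measure α}
    {F : Set α} (hF : MeasurableSet F) {v : ℕ → α → ℝ} (hv : ∀ k, Measurable (v k)) {a : ℝ}
    (hlim : ∀ᵐ x ∂μ, x ∈ F → Tendsto (fun k => v k x) atTop (𝓝 a)) {X : ENNReal}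
    (hX : ∃ᶠ k in atTop, ∫⁻ x in F, ENNReal.ofReal (v k x) ∂μ ≤ X) :
    ENNReal.ofReal a * μ F ≤ X := by
  obtain ⟨ns, hns, hle⟩ := extraction_of_frequently_atTop hX
  calc ENNReal.ofReal a * μ F = ∫⁻ x in F, ENNReal.ofReal a ∂μ := (setLIntegral_const _ _).symm
    _ = ∫⁻ x in F, liminf (fun k => ENNReal.ofReal (v (ns k) x)) atTop ∂μ := by
        refine setLIntegral_congr_fun_ae hF ?_
        filter_upwards [hlim] with x hx hxF
        exact ((ENNReal.continuous_ofReal.tendsto _).comp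
          ((hx hxF).comp hns.tendsto_atTop)).liminf_eq.symm
    _ ≤ liminf (fun k => ∫⁻ x in F, ENNReal.ofReal (v (ns k) x) ∂μ) atTop :=
        lintegral_liminf_le fun k => (hv _).ennreal_ofReal
    _ ≤ liminf (fun _ : ℕ => X) atTop := liminf_le_liminf (Eventually.of_forall hle)
    _ = X := liminf_const _

lemma le_rpow_of_half_mul_le {m K : ENNReal} (hm : m ≠ ⊤) {θ : ℝ} (hθ1 : θ < 1)
    (h : ENNReal.ofReal (1 / 2) * m ≤ K * m ^ θ) : m ≤ (2 * K) ^ (1 / (1 - θ)) := by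
  rcases eq_or_ne m 0 with rfl | h0
  · exact zero_le
  have h2 : (2 : ENNReal) * ENNReal.ofReal (1 / 2) = 1 := by
    rw [show (2 : ENNReal) = ENNReal.ofReal 2 by simp, ← ENNReal.ofReal_mul (by norm_num)]
    norm_num
  have h1 : m ^ (1 - θ) ≤ 2 * K := by
    calc m ^ (1 - θ) = m ^ (-θ) * m := by
          rw [sub_eq_add_neg, add_comm, ENNReal.rpow_add _ _ h0 hm, ENNReal.rpow_one]
      _ = 2 * m ^ (-θ) * (ENNReal.ofReal (1 / 2) * m) := by
          have : 2 * m ^ (-θ) * (ENNReal.ofReal (1 / 2) * m) =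
            (2 * ENNReal.ofReal (1 / 2)) * (m ^ (-θ) * m) := by ring
          rw [this, h2, one_mul]
      _ ≤ 2 * m ^ (-θ) * (K * m ^ θ) := by gcongr
      _ = 2 * K * (m ^ (-θ) * m ^ θ) := by ring
      _ = 2 * K := by
          rw [← ENNReal.rpow_add _ _ h0 hm]
          simp
  have hpos : 0 < 1 - θ := by linarith
  rw [one_div]
  exact (ENNReal.le_rpow_inv_iff hpos).2 h1

lemma isCompact_closed_tube {n : ℕ} {S : Set (Euc n)} (hS : IsCompact S) (hne : S.Nonempty)
    (r : ℝ) : IsCompact {x | Metric.infDist x S ≤ r} := by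
  refine Metric.isCompact_of_isClosed_isBounded
    (isClosed_le (Metric.continuous_infDist_pt S) continuous_const) ?_
  refine (hS.isBounded.thickening (δ := r + 1)).subset fun x hx => ?_
  rw [Metric.mem_thickening_iff]
  exact (Metric.infDist_lt_iff hne).1 (lt_of_le_of_lt hx (lt_add_one r))

open Filter Topology in
/-- The weak-type Poincaré–Sobolev inequality passes to sets of finite perimeter. -/
lemma min_volume_le_of_lintegral_tube_sub_const_le {n : ℕ} (hn : 2 ≤ n) {S : Set (Euc n)}
    (hS : IsCompact S) (hne : S.Nonempty) {r r' : ℝ} (hr : r' < r) {D : ENNReal}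
    (hD : ∀ u : Euc n → ℝ, ContDiff ℝ 1 u → ∃ c : ℝ, ∀ F ⊆ tube S r', MeasurableSet F →
      ∫⁻ x in F, ‖u x - c‖ₑ ≤ D * (∫⁻ x in tube S r', ‖fderiv ℝ u x‖ₑ) * volume F ^ (1 / (n : ℝ)))
    {A : Set (Euc n)} (hA : MeasurableSet A) (hTV : totalVariation (charFn A) (tube S r) ≠ ⊤) :
    min (volume (A ∩ tube S r')) (volume (Aᶜ ∩ tube S r')) ≤
      (2 * (D * totalVariation (charFn A) (tube S r))) ^ ((n : ℝ) / ((n : ℝ) - 1)) := by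
  set P := totalVariation (charFn A) (tube S r) with hP
  have hn1 : (1 : ℝ) < n := by exact_mod_cast (by lia : 1 < n)
  have hθ1 : 1 / (n : ℝ) < 1 := (div_lt_one (by linarith)).2 hn1
  have hexp : (n : ℝ) / ((n : ℝ) - 1) = 1 / (1 - 1 / (n : ℝ)) := by
    have : (n : ℝ) - 1 ≠ 0 := by linarith
    field_simp
  have hu : Measurable (charFn A) := measurable_const.indicator hA
  have hu1 : ∀ x, ‖charFn A x‖ ≤ 1 := fun x => by
    by_cases h : x ∈ A <;> simp [charFn, h]
  have hul : LocallyIntegrable (charFn A) :=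
    (locallyIntegrable_const (1 : ℝ)).mono hu.aestronglyMeasurable
      (ae_of_all _ fun x => by simpa using hu1 x)
  obtain ⟨ε, hε, hmoll⟩ := lintegral_enorm_fderiv_mollify_le hu hu1 hul (isOpen_tube S r)
    (isCompact_closed_tube hS hne r') (fun x hx => lt_of_le_of_lt hx hr) hTV
  let φ : ℕ → ContDiffBump (0 : Euc n) := fun k =>
    ⟨1 / ((k : ℝ) + 1) / 2, 1 / ((k : ℝ) + 1), by positivity, half_lt_self (by positivity)⟩
  have hφ : Tendsto (fun k => (φ k).rOut) atTop (𝓝 0) := tendsto_one_div_add_atTop_nhds_zero_nat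
  have hae : ∀ᵐ x, Tendsto (fun k => mollify (φ k) (charFn A) x) atTop (𝓝 (charFn A x)) :=
    ContDiffBump.ae_convolution_tendsto_right_of_locallyIntegrable (K := 2) hφ
      (Eventually.of_forall fun k => by simp only [φ]; linarith) hul
  have hw : ∀ k, ContDiff ℝ 1 (mollify (φ k) (charFn A)) := fun k =>
    (contDiff_mollify (φ k) hul).of_le (by norm_num)
  choose c hc using fun k => hD _ (hw k)
  have hbound : ∀ᶠ k in atTop, ∀ F ⊆ tube S r', MeasurableSet F →
      ∫⁻ x in F, ‖mollify (φ k) (charFn A) x - c k‖ₑ ≤ D * P * volume F ^ (1 / (n : ℝ)) := by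
    filter_upwards [hφ.eventually (ge_mem_nhds hε)] with k hk F hF hFm
    refine (hc k F hF hFm).trans ?_
    gcongr
    refine le_trans (lintegral_mono_set fun x hx => ?_) (hmoll (φ k) hk)
    exact (show Metric.infDist x S < r' from hx).le
  have htube := (isOpen_tube S r').measurableSet
  have hfin : ∀ B : Set (Euc n), volume (B ∩ tube S r') ≠ ⊤ := fun B =>
    ((measure_mono Set.inter_subset_right).trans_lt
      (volume_tube_ne_top hne hS.isBounded r').lt_top).ne
  rw [hexp]
  -- If `c k ≤ 1/2` infinitely often, `|w_k - c k| ≥ w_k - 1/2 → 1/2` on `A`, where `w_k` is the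
  -- mollified indicator. Otherwise `c k > 1/2` eventually, and `A` and its complement exchange
  -- roles.
  by_cases hfreq : ∃ᶠ k in atTop, c k ≤ 1 / 2
  · refine (min_le_left _ _).trans (le_rpow_of_half_mul_le (hfin A) hθ1 ?_)
    refine ofReal_mul_measure_le_of_frequently (hA.inter htube)
      (v := fun k x => mollify (φ k) (charFn A) x - 1 / 2)
      (fun k => (hw k).continuous.measurable.sub_const _) ?_ ?_
    · filter_upwards [hae] with x hx hxA
      have := hx.sub_const (1 / 2)
      rw [charFn, Set.indicator_of_mem hxA.1] at this
      convert! this using 2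
      norm_num
    · refine (hfreq.and_eventually hbound).mono fun k hk => ?_
      refine le_trans (lintegral_mono fun x => ?_)
        (hk.2 _ Set.inter_subset_right (hA.inter htube))
      rw [← ofReal_norm, Real.norm_eq_abs]
      exact ENNReal.ofReal_le_ofReal (le_trans (by linarith [hk.1]) (le_abs_self _))
  · have hfreq' : ∃ᶠ k in atTop, 1 / 2 ≤ c k :=
      ((not_frequently.1 hfreq).mono fun k hk => (not_le.1 hk).le).frequently
    refine (min_le_right _ _).trans (le_rpow_of_half_mul_le (hfin Aᶜ) hθ1 ?_)
    refine ofReal_mul_measure_le_of_frequently (hA.compl.inter htube)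
      (v := fun k x => 1 / 2 - mollify (φ k) (charFn A) x)
      (fun k => measurable_const.sub (hw k).continuous.measurable) ?_ ?_
    · filter_upwards [hae] with x hx hxA
      have := hx.const_sub (1 / 2)
      rw [charFn, Set.indicator_of_notMem hxA.1] at this
      convert! this using 2
      norm_num
    · refine (hfreq'.and_eventually hbound).mono fun k hk => ?_
      refine le_trans (lintegral_mono fun x => ?_)
        (hk.2 _ Set.inter_subset_right (hA.compl.inter htube))
      rw [← ofReal_norm, Real.norm_eq_abs]
      refine ENNReal.ofReal_le_ofReal (le_trans ?_ (neg_le_abs _))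
      linarith [hk.1]

lemma eLpNorm_charFn {n : ℕ} {A : Set (Euc n)} (hA : MeasurableSet A) (U : Set (Euc n)) :
    eLpNorm (charFn A) 1 (volume.restrict U) = volume (A ∩ U) := by
  rw [charFn, eLpNorm_indicator_const hA one_ne_zero ENNReal.one_ne_top,
    Measure.restrict_apply hA]
  simp

lemma one_sub_charFn {n : ℕ} (A : Set (Euc n)) : (fun x => 1 - charFn A x) = charFn Aᶜ := by
  ext x
  by_cases h : x ∈ A <;> simp [charFn, h]

lemma totalVariation_congr_ae {n : ℕ} {u v : Euc n → ℝ} (h : u =ᵐ[volume] v) (W : Set (Euc n)) :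
    totalVariation u W = totalVariation v W := by
  unfold totalVariation
  refine iSup_congr fun φ => iSup_congr fun _ => congrArg ENNReal.ofReal (integral_congr_ae ?_)
  filter_upwards [h] with x hx
  rw [hx]

-- Mollification loses some radius, so the estimate is first available on smaller tubes, which
-- exhaust the open tube. Radii at least `r / 2` suffice, so the factor `r'^(-1/n)` stays comparable
-- with `r^(-1/n)`.
open Filter Topology in
lemma min_volume_tube_le {n : ℕ} {S A : Set (Euc n)} {r : ℝ} (hr : 0 < r) {X : ENNReal}
    (h : ∀ r' : ℝ, r / 2 ≤ r' → r' < r →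
      min (volume (A ∩ tube S r')) (volume (Aᶜ ∩ tube S r')) ≤ X) :
    min (volume (A ∩ tube S r)) (volume (Aᶜ ∩ tube S r)) ≤ X := by
  set ρ : ℕ → ℝ := fun k => r - r / 2 * (1 / ((k : ℝ) + 1)) with hρ
  have hpos : ∀ k : ℕ, 0 < 1 / ((k : ℝ) + 1) := fun k => by positivity
  have hle1 : ∀ k : ℕ, 1 / ((k : ℝ) + 1) ≤ 1 := fun k =>
    (div_le_one (by positivity)).2 (by linarith [Nat.cast_nonneg (α := ℝ) k])
  have hρr : ∀ k, ρ k < r := fun k => by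
    have := mul_pos (half_pos hr) (hpos k)
    simp only [hρ]
    linarith
  have hρ2 : ∀ k, r / 2 ≤ ρ k := fun k => by
    simp only [hρ]
    nlinarith [hle1 k]
  have hρmono : Monotone ρ := fun i j hij => by
    simp only [hρ]
    have : 1 / ((j : ℝ) + 1) ≤ 1 / ((i : ℝ) + 1) := Nat.one_div_le_one_div hij
    nlinarith
  have hlim : Tendsto ρ atTop (𝓝 r) := by
    have h1 := (tendsto_one_div_add_atTop_nhds_zero_nat (𝕜 := ℝ)).const_mul (r / 2)
    have h2 := h1.const_sub r
    rwa [mul_zero, sub_zero] at h2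
  have hunion : ∀ B : Set (Euc n), ⋃ k, B ∩ tube S (ρ k) = B ∩ tube S r := fun B => by
    rw [← Set.inter_iUnion]
    congr 1
    refine Set.Subset.antisymm (Set.iUnion_subset fun k => tube_mono S (hρr k).le) fun x hx => ?_
    obtain ⟨k, hk⟩ := (hlim.eventually (lt_mem_nhds hx)).exists
    exact Set.mem_iUnion.2 ⟨k, hk⟩
  have htend : ∀ B : Set (Euc n), Tendsto (fun k => volume (B ∩ tube S (ρ k))) atTop
      (𝓝 (volume (B ∩ tube S r))) := fun B => by
    rw [← hunion B]
    exact tendsto_measure_iUnion_atTop fun i j hij =>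
      Set.inter_subset_inter_right _ (tube_mono S (hρmono hij))
  exact le_of_tendsto' ((htend A).min (htend Aᶜ)) fun k => h _ (hρ2 k) (hρr k)

theorem lemma4p2 (n : ℕ) (hn : 2 ≤ n) (E : Set (Euc n)) (hE : IsOpen E)
    (hconn : IsConnected (frontier E)) (hcomp : IsCompact (frontier E))
    (hC2 : IsC2Hypersurface (frontier E))
    (δ : ℝ) (hδ : 0 < δ) (hδκ : δ < 1 / (2 * maxAbsCurvature (frontier E))) :
    ∃ C : ℝ, 0 < C ∧ ∀ r : ℝ, 0 < r → r < δ → ∀ A : Set (Euc n), IsBVloc (charFn A) →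
      min (eLpNorm (charFn A) 1 (volume.restrict (tube (frontier E) r)))
          (eLpNorm (fun x => 1 - charFn A x) 1 (volume.restrict (tube (frontier E) r)))
        ≤ ENNReal.ofReal ((δ / r) ^ (1 / ((n : ℝ) - 1)) * C) *
            totalVariation (charFn A) (tube (frontier E) r) ^ ((n : ℝ) / ((n : ℝ) - 1)) := by
  set S := frontier E with hS
  have hn1 : (1 : ℝ) < n := by exact_mod_cast (by lia : 1 < n)
  have hn0 : 0 < (n : ℝ) - 1 := by linarith
  set q : ℝ := (n : ℝ) / ((n : ℝ) - 1) with hq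
  set p : ℝ := 1 / ((n : ℝ) - 1) with hp
  have hqpos : 0 < q := by positivity
  obtain ⟨C, hC, hmain⟩ := exists_lintegral_tube_sub_const_le hn hconn hcomp
    (fun z hz => (hC2 z hz).elim fun f hf => exists_straighteningChart hz hf) hδ
  -- `C + 1` instead of `C` makes the final constant strictly positive.
  set M : ENNReal := (2 * (C + 1)) ^ q with hM
  have hMtop : M ≠ ⊤ := ENNReal.rpow_ne_top_of_nonneg hqpos.le (by finiteness)
  have hM0 : M ≠ 0 := by simp [hM, ENNReal.rpow_eq_zero_iff, hqpos.le]
  have hMpos : 0 < M.toReal := ENNReal.toReal_pos hM0 hMtop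
  -- `(2 / δ)^p` turns `(δ / r)^p` into `(r / 2)^(-p)`, which is `(r / 2)^(-1/n)` raised to the
  -- power `q`.
  refine ⟨M.toReal * (2 / δ) ^ p, by positivity, fun r hr hrδ A hA => ?_⟩
  -- Local integrability of the indicator makes `A` only null-measurable; both norms and the total
  -- variation are unchanged on a measurable representative.
  obtain ⟨B, -, hB, hBA⟩ : ∃ B ⊇ A, MeasurableSet B ∧ B =ᵐ[volume] A := by
    refine NullMeasurableSet.exists_measurable_superset_ae_eq ?_
    exact (aemeasurable_indicator_const_iff (1 : ℝ)).1 hA.1.aestronglyMeasurable.aemeasurable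
  have hAB : charFn A =ᵐ[volume] charFn B := indicator_ae_eq_of_ae_eq_set hBA.symm
  have hTV : totalVariation (charFn B) (tube S r) ≠ ⊤ := by
    rw [← totalVariation_congr_ae hAB]
    refine (hA.2 _ (isOpen_tube S r) ?_).ne
    exact (isCompact_closed_tube hcomp hconn.nonempty r).isBounded.subset fun x hx =>
      (show Metric.infDist x S < r from hx).le
  have hAB' : (fun x => 1 - charFn A x) =ᵐ[volume] fun x => 1 - charFn B x := by
    filter_upwards [hAB] with x hx
    rw [hx]
  rw [totalVariation_congr_ae hAB, eLpNorm_congr_ae (ae_restrict_of_ae hAB),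
    eLpNorm_congr_ae (ae_restrict_of_ae hAB'), one_sub_charFn, eLpNorm_charFn hB,
    eLpNorm_charFn hB.compl]
  set P := totalVariation (charFn B) (tube S r) with hP
  have hX : (2 * ((C + 1) * ENNReal.ofReal (r / 2) ^ (-(1 / (n : ℝ))) * P)) ^ q =
      ENNReal.ofReal ((δ / r) ^ p * (M.toReal * (2 / δ) ^ p)) * P ^ q := by
    have h1 : (δ / r) ^ p * (M.toReal * (2 / δ) ^ p) = M.toReal * (r / 2) ^ (-p) := by
      rw [mul_left_comm, ← Real.mul_rpow (by positivity) (by positivity), Real.rpow_neg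
        (by positivity), ← Real.inv_rpow (by positivity)]
      congr 2
      field_simp
    have h2 : -(1 / (n : ℝ)) * q = -p := by
      rw [hq, hp]
      field_simp
    rw [h1, ENNReal.ofReal_mul hMpos.le, ENNReal.ofReal_toReal hMtop,
      ← ENNReal.ofReal_rpow_of_pos (by positivity), hM, ← h2, ENNReal.rpow_mul,
      ← ENNReal.mul_rpow_of_nonneg _ _ hqpos.le, ← ENNReal.mul_rpow_of_nonneg _ _ hqpos.le]
    congr 1
    ring
  rw [← hX]
  refine min_volume_tube_le hr fun r' hr' hr'r => ?_
  have hr'0 : 0 < r' := by linarith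
  have hbase := min_volume_le_of_lintegral_tube_sub_const_le hn hcomp hconn.nonempty hr'r
    (hmain r' hr'0 (hr'r.trans hrδ)) hB hTV
  refine hbase.trans ?_
  have hle : ENNReal.ofReal r' ^ (-(1 / (n : ℝ))) ≤ ENNReal.ofReal (r / 2) ^ (-(1 / (n : ℝ))) := by
    rw [ENNReal.rpow_neg, ENNReal.rpow_neg, ENNReal.inv_le_inv]
    gcongr
  gcongr
  exact le_self_add
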